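/- Let $N\ge 2$ and $M\ge 1$ be integers. The $(N,M)$ energy-constrained walk is the Markov chain $(X_n,\eta_n)_{n\ge0}$ on $\{0,\dots,N\}\times\{0,\dots,M\}$ with $(X_0,\eta_0)=(1,M)$ and the following transitions. From $(x,i)$ with $0<x<N$ and $i\ge1$ it moves to $(x+1,i-1)$ or $(x-1,i-1)$ with probability $1/2$ each; from $(x,0)$ with $0<x<N$ it stays put; from $(0,i)$ it moves to $(1,M)$ and from $(N,i)$ it moves to $(N-1,M)$. Its lifetime is $\lambda=\min\{n\ge0: 0<X_n<N,\ \eta_n=0\}$ (with $\min\emptyset=\infty$). Write $\Pr^{N,M}$ and $\mathbb E^{N,M}$ for probability and expectation under the law of this chain. For $y,\rho>0$ and $s\in\mathbb R$ put $$H(y)=\sum_{k=1}^\infty e^{-\pi^2(2k-1)^2y/2},\qquad G(\rho,s)=\frac{s}{H(\rho)}\int_0^1 e^{sv}\bigl(H(v\rho)-H(\rho)\bigr)\,dv,$$ $$s_\rho=\sup\{s>0: G(\rho,s)<1\},\qquad \phi_\rho(s)=\frac1{1-G(\rho,s)}\ (s<s_\rho),\qquad \mu(\rho)=\frac1{\rho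 H(\rho)}\int_0^\rho H(y)\,dy-1 .$$ **Theorem.** (i) For every $\rho\in(0,\infty)$ there is an infinitely divisible probability law on $\mathbb R$, depending only on $\rho$, such that a random variable $\xi_\rho$ with this law satisfies $\mathbb E[e^{s\xi_\rho}]=\phi_\rho(s)<\infty$ for all $s<s_\rho$, is integrable with $\mathbb E\,\xi_\rho=\mu(\rho)$, and such that the following holds. For every sequence $(N_M)_{M\ge1}$ of integers $N_M\ge2$ with $N_M\to\infty$ and $M/N_M^2\to\rho$ as $M\to\infty$, the lifetime $\lambda$ of the $(N_M,M)$ walk started at $(1,M)$ is almost surely finite for all sufficiently large $M$, and, as $M\to\infty$, $$\frac{\lambda}{M}\ \overset{d}{\longrightarrow}\ 1+\xi_\rho,\qquad \frac{\mathbb E^{N_M,M}\lambda}{M}\to 1+\mu(\rho).$$ (ii) $\displaystyle\lim_{\rho\downarrow0}\mu(\rho)=1$, and $\displaystyle\mu(\rho)=\frac{e^{\pi^2\rho/2}}{4\rho}\,(1+o(1))$ as $\rho\to\infty$. -/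

import Mathlib

open Set Filter Topology MeasureTheory ProbabilityTheory Asymptotics
open scoped ENNReal

namespace EnergyWalk

/-! ### The energy-constrained random walk -/

/-- A state `(x, i)` of the chain: the location `x` of the walker and its energy level `i`. -/
abbrev State : Type := ℤ × ℕ

/-- The one-step transition law of the finite-capacity model on `{0, …, N}` with energy capacity
`M`. At a boundary site `0` or `N` the walker moves to the neighbouring interior site and its
energy becomes `M`. At an interior site with energy `0` it stays put for ever; at an interior site
with positive energy it makes a simple symmetric random walk step, which costs one unit of energy.
(For `2 ≤ N`, a chain started in `{0, …, N} × {0, …, M}` stays there.) -/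
noncomputable def stepLaw (N M : ℕ) (z : State) : Measure State :=
  if z.1 = 0 then Measure.dirac (1, M)
  else if z.1 = N then Measure.dirac ((N : ℤ) - 1, M)
  else
    match z.2 with
    | 0 => Measure.dirac (z.1, 0)
    | i + 1 => (2⁻¹ : ℝ≥0∞) • Measure.dirac (z.1 + 1, i) +
        (2⁻¹ : ℝ≥0∞) • Measure.dirac (z.1 - 1, i)

instance stepLaw_isProbabilityMeasure (N M : ℕ) (z : State) :
    IsProbabilityMeasure (stepLaw N M z) := by
  obtain ⟨x, i⟩ := z
  unfold stepLaw
  split_ifs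
  · infer_instance
  · infer_instance
  · cases i with
    | zero => simp only; infer_instance
    | succ i =>
      refine ⟨?_⟩
      simp [ENNReal.inv_two_add_inv_two]

/-- The transition law as a Markov kernel on the state space. -/
noncomputable def stepKernel (N M : ℕ) : Kernel State State where
  toFun := stepLaw N M
  measurable' := Measurable.of_discrete

instance stepKernel_isMarkovKernel (N M : ℕ) : IsMarkovKernel (stepKernel N M) :=
  ⟨fun z => stepLaw_isProbabilityMeasure N M z⟩

/-- The law on trajectory space of the `(N, M, z)` model: the time-homogeneous Markov chain
`ζ₀, ζ₁, …` with `ζ₀ = z` and transition kernel `stepKernel N M`. -/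
noncomputable def chainLaw (N M : ℕ) (z : State) : Measure (ℕ → State) :=
  Kernel.trajMeasure (X := fun _ => State) (Measure.dirac z)
    (fun n => (stepKernel N M).comap
      (fun h : (i : Finset.Iic n) → State => h ⟨n, Finset.mem_Iic.2 le_rfl⟩)
      (measurable_pi_apply _))

instance chainLaw_isProbabilityMeasure (N M : ℕ) (z : State) :
    IsProbabilityMeasure (chainLaw N M z) := by
  unfold chainLaw
  infer_instance

/-- The total lifetime `λ` of a trajectory: the first time at which the walker is in the interior
`{1, …, N - 1}` with energy `0`, and `⊤` if there is no such time. -/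
noncomputable def lifetime (N : ℕ) (ζ : ℕ → State) : ℕ∞ :=
  sInf ((fun n : ℕ => (n : ℕ∞)) '' {n : ℕ | 0 < (ζ n).1 ∧ (ζ n).1 < N ∧ (ζ n).2 = 0})

/-! ### The limit law -/

/-- `H(y) = ∑_{k ≥ 1} exp(-π² (2k-1)² y / 2)`; the summation index here is `k - 1`. -/
noncomputable def H (y : ℝ) : ℝ :=
  ∑' k : ℕ, Real.exp (-(Real.pi ^ 2 * (2 * (k : ℝ) + 1) ^ 2 * y / 2))

/-- `G(ρ, s) = (s / H(ρ)) ∫₀¹ e^{sv} (H(vρ) - H(ρ)) dv`. -/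
noncomputable def G (ρ s : ℝ) : ℝ :=
  s / H ρ * ∫ v in (0 : ℝ)..1, Real.exp (s * v) * (H (v * ρ) - H ρ)

/-- `s_ρ = sup {s > 0 : G(ρ, s) < 1}`. -/
noncomputable def sMax (ρ : ℝ) : ℝ := sSup {s : ℝ | 0 < s ∧ G ρ s < 1}

/-- `φ_ρ(s) = 1 / (1 - G(ρ, s))`. -/
noncomputable def phi (ρ s : ℝ) : ℝ := 1 / (1 - G ρ s)

/-- `μ(ρ) = (1 / (ρ H(ρ))) ∫₀^ρ H(y) dy - 1`. -/
noncomputable def mu (ρ : ℝ) : ℝ := 1 / (ρ * H ρ) * (∫ y in (0 : ℝ)..ρ, H y) - 1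

/-- A probability measure on `ℝ` is infinitely divisible if for every `n ≥ 1` it is the law of a
sum of `n` independent identically distributed random variables. -/
def IsInfinitelyDivisible (ν : ProbabilityMeasure ℝ) : Prop :=
  ∀ n : ℕ, 1 ≤ n → ∃ κ : ProbabilityMeasure ℝ,
    (Measure.pi fun _ : Fin n => (κ : Measure ℝ)).map (fun x => ∑ i, x i) = (ν : Measure ℝ)

end EnergyWalk

/-! The argument is a renewal argument. Let τ be the hitting time of {0, N} by simple random walk
from 1. Started at (1, M), the chain either has τ > M and dies after exactly M steps, or is
refreshed at time τ + 1 to a state equivalent, by the symmetry x ↦ N - x, to (1, M). So λ is M plus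
a geometric number of independent copies of τ + 1 conditioned on τ ≤ M, and λ / M has Laplace
transform e^s q / (1 - A), where q = P(τ > M) and A = E[e^{s(τ+1)/M}; τ ≤ M] (`tsum_lifetimeProb`).

Diagonalising the killed walk gives an exact formula for P(τ > n), whence N P(τ > n) → 4 H(y) when n
/ N² → y (`tendsto_mul_surv_one`). Summation by parts writes 1 - A through these probabilities, and
dominated convergence gives (1 - A) / q → 1 - G(ρ, s) (`tendsto_one_sub_hitGen_div`), so q / (1 - A)
→ φ_ρ(s).

Convergence of Laplace transforms on an open set containing 0 yields weak convergence and
convergence of means (`exists_tendsto_of_tendsto_laplace`, `tendsto_lintegral_of_le_abs`). Replacing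
geometric weights by negative binomial ones realises (q / (1 - A))^α for every α > 0
(`exists_laplace_eq_rpow`); in the limit φ_ρ^α is the transform of a law. The case α = 1 is the law
of ξ_ρ, and α = 1/n gives infinite divisibility. The mean is φ_ρ'(0) = μ(ρ).

For (ii), Jacobi's theta identity gives H(y) ~ c / √y at 0, so μ + 1 tends to ∫₀¹ v^{-1/2} dv = 2;
at infinity H(ρ) ~ e^{-π²ρ/2} and ∫₀^∞ H = 1/4. -/

namespace EnergyWalk

/-! ### Exponential moments and weak convergence -/

/-- The two-sided Laplace transform `∫ e^{sx} μ(dx)`, with values in `[0, ∞]`. -/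
noncomputable def laplace (μ : Measure ℝ) (s : ℝ) : ℝ≥0∞ :=
  ∫⁻ x, ENNReal.ofReal (Real.exp (s * x)) ∂μ

/-- If `μ i → ν` weakly, `f = o(g)` at infinity and `∫ g dμ i` is eventually bounded, then
`∫ f dμ i → ∫ f dν`, and the limit is finite. -/
theorem tendsto_lintegral_of_isLittleO {ι : Type*} {l : Filter ι} [l.NeBot]
    {μ : ι → ProbabilityMeasure ℝ}
    {ν : ProbabilityMeasure ℝ} (hμ : Tendsto μ l (𝓝 ν)) {f g : ℝ → ℝ} (hf : Continuous f)
    (hf0 : ∀ x, 0 ≤ f x) (hg : Measurable g) (hg0 : ∀ x, 0 ≤ g x) (hfg : f =o[cocompact ℝ] g)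
    {C : ℝ≥0∞}
    (hC : C ≠ ∞) (hgC : ∀ᶠ i in l, ∫⁻ x, ENNReal.ofReal (g x) ∂(μ i : Measure ℝ) ≤ C) :
    Tendsto (fun i => ∫⁻ x, ENNReal.ofReal (f x) ∂(μ i : Measure ℝ)) l
      (𝓝 (∫⁻ x, ENNReal.ofReal (f x) ∂(ν : Measure ℝ))) ∧
    ∫⁻ x, ENNReal.ofReal (f x) ∂(ν : Measure ℝ) < ∞ := by
  have hfm : Measurable f := hf.measurable
  have htr (K : ℕ) : Tendsto (fun i => ∫⁻ x, ENNReal.ofReal (min (f x) K) ∂(μ i : Measure ℝ)) l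
      (𝓝 (∫⁻ x, ENNReal.ofReal (min (f x) K) ∂(ν : Measure ℝ))) := by
    let F : BoundedContinuousFunction ℝ NNReal :=
      BoundedContinuousFunction.mkOfBound
        ⟨fun x => (min (f x) K).toNNReal, by fun_prop⟩ (K : ℝ) (by
          intro x y
          have h0 : ∀ z, 0 ≤ min (f z) K := fun z => le_min (hf0 z) (by positivity)
          rw [NNReal.dist_eq]
          simp only [ContinuousMap.coe_mk]
          rw [Real.coe_toNNReal _ (h0 x), Real.coe_toNNReal _ (h0 y), abs_le]
          constructor <;> linarith [h0 x, h0 y, min_le_right (f x) (K : ℝ),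
            min_le_right (f y) (K : ℝ)])
    exact ProbabilityMeasure.tendsto_iff_forall_lintegral_tendsto.1 hμ F
  have hKle (m : Measure ℝ) (K : ℕ) :
      ∫⁻ x, ENNReal.ofReal (min (f x) K) ∂m ≤ ∫⁻ x, ENNReal.ofReal (f x) ∂m := by
    gcongr
    exact min_le_left _ _
  have hsup : ∫⁻ x, ENNReal.ofReal (f x) ∂(ν : Measure ℝ) =
      ⨆ K : ℕ, ∫⁻ x, ENNReal.ofReal (min (f x) K) ∂(ν : Measure ℝ) := by
    rw [← lintegral_iSup (fun K => by fun_prop)]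
    · refine lintegral_congr fun x => le_antisymm ?_ ?_
      · obtain ⟨K, hK⟩ := exists_nat_ge (f x)
        refine le_iSup_of_le K ?_
        rw [min_eq_left hK]
      · exact iSup_le fun K => ENNReal.ofReal_le_ofReal (min_le_left _ _)
    · intro a b hab x
      exact ENNReal.ofReal_le_ofReal (min_le_min_left _ (by exact_mod_cast hab))
  -- Off a compact set f ≤ ε g; on it f is bounded by some K, so truncation at K changes nothing.
  have hdom (ε : ℝ) (hε : 0 < ε) : ∃ K : ℕ, ∀ x, f x ≤ min (f x) K + ε * g x := by
    have h1 := hfg.bound hε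
    rw [Filter.Eventually, Filter.mem_cocompact] at h1
    obtain ⟨t, ht, hts⟩ := h1
    obtain ⟨B, hB⟩ := ht.bddAbove_image hf.continuousOn
    obtain ⟨K, hK⟩ := exists_nat_ge B
    refine ⟨K, fun x => ?_⟩
    by_cases hx : x ∈ t
    · have : f x ≤ K := (hB ⟨x, hx, rfl⟩).trans hK
      rw [min_eq_left this]
      nlinarith [hg0 x]
    · have h2 : ‖f x‖ ≤ ε * ‖g x‖ := hts hx
      rw [Real.norm_of_nonneg (hf0 x), Real.norm_of_nonneg (hg0 x)] at h2
      have : 0 ≤ min (f x) (K : ℝ) := le_min (hf0 x) (by positivity)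
      linarith
  have hup (ε : ℝ) (hε : 0 < ε) : ∃ K : ℕ, ∀ᶠ i in l,
      ∫⁻ x, ENNReal.ofReal (f x) ∂(μ i : Measure ℝ) ≤
      ∫⁻ x, ENNReal.ofReal (min (f x) K) ∂(μ i : Measure ℝ) + ENNReal.ofReal ε * C := by
    obtain ⟨K, hK⟩ := hdom ε hε
    refine ⟨K, hgC.mono fun i hi => ?_⟩
    calc ∫⁻ x, ENNReal.ofReal (f x) ∂(μ i : Measure ℝ)
        ≤ ∫⁻ x, (ENNReal.ofReal (min (f x) K) + ENNReal.ofReal ε * ENNReal.ofReal (g x))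
            ∂(μ i : Measure ℝ) := by
          refine lintegral_mono fun x => ?_
          rw [← ENNReal.ofReal_mul hε.le, ← ENNReal.ofReal_add (le_min (hf0 x) (by positivity))
            (mul_nonneg hε.le (hg0 x))]
          exact ENNReal.ofReal_le_ofReal (hK x)
      _ = _ := by
          rw [lintegral_add_left (by fun_prop), lintegral_const_mul _ (by fun_prop)]
      _ ≤ _ := by gcongr
  have hfin : ∫⁻ x, ENNReal.ofReal (f x) ∂(ν : Measure ℝ) < ∞ := by
    obtain ⟨K, hK⟩ := hup 1 one_pos
    have hb : ∀ K' : ℕ, ∫⁻ x, ENNReal.ofReal (min (f x) K') ∂(ν : Measure ℝ) ≤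
        ∫⁻ x, ENNReal.ofReal (min (f x) K) ∂(ν : Measure ℝ) + ENNReal.ofReal 1 * C := by
      intro K'
      refine le_of_tendsto_of_tendsto (htr K') ((htr K).add_const _) ?_
      filter_upwards [hK] with i hi
      exact (hKle _ K').trans hi
    rw [hsup]
    refine (iSup_le hb).trans_lt (ENNReal.add_lt_top.2 ⟨?_, by simp [hC.lt_top]⟩)
    calc ∫⁻ x, ENNReal.ofReal (min (f x) K) ∂(ν : Measure ℝ)
        ≤ ∫⁻ _, ENNReal.ofReal K ∂(ν : Measure ℝ) := by
          gcongr; exact min_le_right _ _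
      _ < ∞ := by simp
  refine ⟨?_, hfin⟩
  refine tendsto_of_le_liminf_of_limsup_le ?_ ?_
  · rw [hsup]
    refine iSup_le fun K => ?_
    rw [← (htr K).liminf_eq]
    exact liminf_le_liminf (Eventually.of_forall fun i => hKle _ K)
  · refine ENNReal.le_of_forall_pos_le_add fun δ hδ _ => ?_
    have hC' : C.toReal + 1 ≠ 0 := by positivity
    -- The denominator C + 1 makes the error at most δ even when C = 0.
    obtain ⟨K, hK⟩ := hup (δ / (C.toReal + 1)) (by positivity)
    calc limsup (fun i => ∫⁻ x, ENNReal.ofReal (f x) ∂(μ i : Measure ℝ)) l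
        ≤ limsup (fun i => ∫⁻ x, ENNReal.ofReal (min (f x) K) ∂(μ i : Measure ℝ) +
            ENNReal.ofReal (δ / (C.toReal + 1)) * C) l := limsup_le_limsup hK
      _ = ∫⁻ x, ENNReal.ofReal (min (f x) K) ∂(ν : Measure ℝ) +
            ENNReal.ofReal (δ / (C.toReal + 1)) * C := ((htr K).add_const _).limsup_eq
      _ ≤ _ := by
          gcongr
          · exact min_le_left _ _
          · rw [← ENNReal.ofReal_toReal hC, ← ENNReal.ofReal_mul (by positivity),
              ← ENNReal.ofReal_coe_nnreal, ENNReal.toReal_ofReal (by positivity)]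
            apply ENNReal.ofReal_le_ofReal
            rw [div_mul_eq_mul_div, div_le_iff₀ (by positivity)]
            nlinarith [δ.2, C.toReal_nonneg, NNReal.coe_nonneg δ]

/-- The exponent s₁ dominates at -∞ and s₂ at +∞. Bounded moments at two exponents around s thus
make e^{sx} uniformly integrable. -/
theorem exp_isLittleO_cocompact {s₁ s s₂ : ℝ} (h₁ : s₁ < s) (h₂ : s < s₂) :
    (fun x => Real.exp (s * x)) =o[cocompact ℝ]
      fun x => Real.exp (s₁ * x) + Real.exp (s₂ * x) := by
  rw [cocompact_eq_atBot_atTop, isLittleO_sup]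
  constructor
  · refine IsLittleO.trans_isBigO (g := fun x => Real.exp (s₁ * x)) ?_ ?_
    · rw [Real.isLittleO_exp_comp_exp_comp]
      simp_rw [← sub_mul]
      exact tendsto_id.const_mul_atBot_of_neg (by linarith)
    · refine IsBigO.of_bound 1 (Eventually.of_forall fun x => ?_)
      rw [Real.norm_of_nonneg (by positivity), Real.norm_of_nonneg (by positivity)]
      linarith [Real.exp_pos (s₂ * x)]
  · refine IsLittleO.trans_isBigO (g := fun x => Real.exp (s₂ * x)) ?_ ?_
    · rw [Real.isLittleO_exp_comp_exp_comp]
      simp_rw [← sub_mul]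
      exact tendsto_id.const_mul_atTop (by linarith)
    · refine IsBigO.of_bound 1 (Eventually.of_forall fun x => ?_)
      rw [Real.norm_of_nonneg (by positivity), Real.norm_of_nonneg (by positivity)]
      linarith [Real.exp_pos (s₁ * x)]

theorem abs_isLittleO_cocompact {s : ℝ} (hs : 0 < s) :
    (fun x : ℝ => |x|) =o[cocompact ℝ] fun x => Real.exp (-s * x) + Real.exp (s * x) := by
  have key : Tendsto (fun x : ℝ => |x|) (cocompact ℝ) atTop := tendsto_norm_cocompact_atTop
  have h := (isLittleO_pow_exp_pos_mul_atTop 1 hs).comp_tendsto key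
  refine IsLittleO.trans_isBigO (h.congr_left (by simp)) ?_
  refine IsBigO.of_bound 1 (Eventually.of_forall fun x => ?_)
  simp only [Function.comp]
  rw [Real.norm_of_nonneg (by positivity), Real.norm_of_nonneg (by positivity)]
  rcases abs_cases x with ⟨h, _⟩ | ⟨h, _⟩ <;> rw [h]
  · linarith [Real.exp_pos (-s * x)]
  · rw [mul_neg, ← neg_mul]
    linarith [Real.exp_pos (s * x)]

theorem lintegral_exp_add_exp (μ : Measure ℝ) (s₁ s₂ : ℝ) :
    ∫⁻ x, ENNReal.ofReal (Real.exp (s₁ * x) + Real.exp (s₂ * x)) ∂μ =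
      laplace μ s₁ + laplace μ s₂ := by
  simp_rw [laplace]
  rw [← lintegral_add_left (by fun_prop)]
  refine lintegral_congr fun x => ?_
  rw [ENNReal.ofReal_add (by positivity) (by positivity)]

theorem integrable_exp_iff (μ : Measure ℝ) (s : ℝ) :
    Integrable (fun x => Real.exp (s * x)) μ ↔ laplace μ s < ∞ := by
  rw [← lintegral_ofReal_ne_top_iff_integrable (by fun_prop)
    (Eventually.of_forall fun x => by positivity), lt_top_iff_ne_top]
  rfl

theorem laplace_eq_ofReal_mgf {μ : Measure ℝ} {s : ℝ} (h : laplace μ s < ∞) :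
    laplace μ s = ENNReal.ofReal (mgf id μ s) := by
  have := (integrable_exp_iff μ s).2 h
  change laplace μ s = ENNReal.ofReal (∫ x, Real.exp (s * x) ∂μ)
  rw [ofReal_integral_eq_lintegral_ofReal this (Eventually.of_forall fun x => by positivity)]
  rfl

theorem mgf_eq_toReal_laplace {μ : Measure ℝ} {s : ℝ} (h : laplace μ s < ∞) :
    mgf id μ s = (laplace μ s).toReal := by
  rw [laplace_eq_ofReal_mgf h, ENNReal.toReal_ofReal mgf_nonneg]

/-- A law on the line is determined by its Laplace transform near `0`. -/
theorem ext_of_laplace_eq {μ ν : ProbabilityMeasure ℝ} {I : Set ℝ} (hI : IsOpen I)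
    (h0 : (0 : ℝ) ∈ I) (hfin : ∀ s ∈ I, laplace μ s < ∞)
    (h : ∀ s ∈ I, laplace μ s = laplace ν s) : μ = ν := by
  obtain ⟨δ, hδ, hball⟩ := Metric.isOpen_iff.1 hI 0 h0
  have hmem : ∀ s : ℝ, |s| < δ → s ∈ I := fun s hs => hball (by simpa using hs)
  -- Both complex moment generating functions are analytic on this vertical strip. They agree on its
  -- real points, hence on the whole strip, in particular on the imaginary axis, where they are the
  -- characteristic functions.
  set U : Set ℂ := Complex.re ⁻¹' (Ioo (-δ) δ) with hU
  have hint (m : ProbabilityMeasure ℝ) (hm : ∀ s ∈ I, laplace m s < ∞) :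
      U ⊆ {z | z.re ∈ interior (integrableExpSet id (m : Measure ℝ))} := by
    intro z hz
    have hsub : Ioo (-δ) δ ⊆ integrableExpSet id (m : Measure ℝ) := by
      intro s hs
      exact (integrable_exp_iff _ s).2 (hm s (hmem s (abs_lt.2 hs)))
    exact (isOpen_Ioo.subset_interior_iff.2 hsub) hz
  have hfin' : ∀ s ∈ I, laplace ν s < ∞ := fun s hs => h s hs ▸ hfin s hs
  have hpre : IsPreconnected U :=
    ((convex_Ioo (-δ) δ).linear_preimage Complex.reLm).isPreconnected
  have hEq : EqOn (complexMGF id (μ : Measure ℝ)) (complexMGF id (ν : Measure ℝ)) U := by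
    refine (analyticOnNhd_complexMGF.mono
      (hint μ hfin)).eqOn_of_preconnected_of_frequently_eq
      (analyticOnNhd_complexMGF.mono (hint ν hfin')) hpre (z₀ := 0)
      (by simp [hU, hδ]) ?_
    have h1 : ∃ᶠ x : ℝ in 𝓝[≠] 0, x ∈ Ioo (-δ) δ :=
      (eventually_nhdsWithin_of_eventually_nhds
        (Ioo_mem_nhds (by linarith) hδ)).frequently
    have h2 : Tendsto (fun x : ℝ => (x : ℂ)) (𝓝[≠] 0) (𝓝[≠] 0) := by
      refine tendsto_nhdsWithin_iff.2 ⟨?_, ?_⟩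
      · exact (Complex.continuous_ofReal.tendsto' 0 0 (by simp)).mono_left nhdsWithin_le_nhds
      · filter_upwards [self_mem_nhdsWithin] with x hx
        simpa using hx
    refine h2.frequently (h1.mono fun x hx => ?_)
    have hxI := hmem x (abs_lt.2 hx)
    rw [complexMGF_ofReal, complexMGF_ofReal, mgf_eq_toReal_laplace (hfin x hxI),
      mgf_eq_toReal_laplace (hfin' x hxI), h x hxI]
  suffices hm : (μ : Measure ℝ) = ν from Subtype.ext hm
  refine Measure.ext_of_charFun (funext fun t => ?_)
  rw [← complexMGF_id_mul_I, ← complexMGF_id_mul_I]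
  exact hEq (by simp [hU, hδ])

/-- Since I is open, the exponents s ± δ/2 also lie in I and bound the moments that control e^{sx}
along the sequence. -/
theorem tendsto_laplace_of_tendsto {ι : Type*} {l : Filter ι} [l.NeBot]
    {μ : ι → ProbabilityMeasure ℝ} {ν : ProbabilityMeasure ℝ} (hμ : Tendsto μ l (𝓝 ν))
    {I : Set ℝ} (hI : IsOpen I) {φ : ℝ → ℝ}
    (h : ∀ s ∈ I, Tendsto (fun i => laplace (μ i) s) l (𝓝 (ENNReal.ofReal (φ s))))
    {s : ℝ} (hs : s ∈ I) : laplace ν s = ENNReal.ofReal (φ s) := by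
  obtain ⟨δ, hδ, hball⟩ := Metric.isOpen_iff.1 hI s hs
  have h1 : s - δ / 2 ∈ I := hball (by simp [abs_of_pos hδ, hδ])
  have h2 : s + δ / 2 ∈ I := hball (by simp [abs_of_pos hδ, hδ])
  have hsum := (h _ h1).add (h _ h2)
  have hbd := hsum.eventually_le_const
    (u := ENNReal.ofReal (φ (s - δ / 2)) + ENNReal.ofReal (φ (s + δ / 2)) + 1)
    (ENNReal.lt_add_right (by simp) (by simp))
  have := (tendsto_lintegral_of_isLittleO hμ (f := fun x => Real.exp (s * x))
    (g := fun x => Real.exp ((s - δ / 2) * x) + Real.exp ((s + δ / 2) * x)) (by fun_prop)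
    (fun x => by positivity) (by fun_prop) (fun x => by positivity)
    (exp_isLittleO_cocompact (by linarith) (by linarith))
    (C := ENNReal.ofReal (φ (s - δ / 2)) + ENNReal.ofReal (φ (s + δ / 2)) + 1) (by simp)
    (by simpa only [lintegral_exp_add_exp] using hbd)).1
  exact tendsto_nhds_unique this (h s hs)

/-- The expectation of `|x|` converges along a weakly convergent sequence with exponential
moments that converge near `0`. -/
theorem tendsto_lintegral_of_le_abs {ι : Type*} {l : Filter ι} [l.NeBot]
    {μ : ι → ProbabilityMeasure ℝ} {ν : ProbabilityMeasure ℝ} (hμ : Tendsto μ l (𝓝 ν))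
    {I : Set ℝ} (hI : IsOpen I) (h0 : (0 : ℝ) ∈ I) {φ : ℝ → ℝ}
    (h : ∀ s ∈ I, Tendsto (fun i => laplace (μ i) s) l (𝓝 (ENNReal.ofReal (φ s))))
    {f : ℝ → ℝ} (hf : Continuous f) (hf0 : ∀ x, 0 ≤ f x) (hfle : ∀ x, f x ≤ |x|) :
    Tendsto (fun i => ∫⁻ x, ENNReal.ofReal (f x) ∂(μ i : Measure ℝ)) l
      (𝓝 (∫⁻ x, ENNReal.ofReal (f x) ∂(ν : Measure ℝ))) := by
  obtain ⟨δ, hδ, hball⟩ := Metric.isOpen_iff.1 hI 0 h0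
  have h1 : -(δ / 2) ∈ I := hball (by simp [abs_of_pos hδ, hδ])
  have h2 : δ / 2 ∈ I := hball (by simp [abs_of_pos hδ, hδ])
  have hsum := (h _ h1).add (h _ h2)
  have hbd := hsum.eventually_le_const
    (u := ENNReal.ofReal (φ (-(δ / 2))) + ENNReal.ofReal (φ (δ / 2)) + 1)
    (ENNReal.lt_add_right (by simp) (by simp))
  refine (tendsto_lintegral_of_isLittleO hμ hf
    (g := fun x => Real.exp (-(δ / 2) * x) + Real.exp ((δ / 2) * x)) hf0
    (by fun_prop) (fun x => by positivity)
    (IsBigO.trans_isLittleO (IsBigO.of_bound 1 (Eventually.of_forall fun x => ?_))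
      (abs_isLittleO_cocompact (half_pos hδ)))
    (C := ENNReal.ofReal (φ (-(δ / 2))) + ENNReal.ofReal (φ (δ / 2)) + 1) (by simp)
    (by simpa only [lintegral_exp_add_exp] using hbd)).1
  rw [Real.norm_of_nonneg (hf0 x), Real.norm_of_nonneg (abs_nonneg x), one_mul]
  exact hfle x

/-- Convergence of Laplace transforms near `0` to a finite limit implies weak convergence. -/
theorem exists_tendsto_of_tendsto_laplace {μ : ℕ → ProbabilityMeasure ℝ} {I : Set ℝ}
    (hI : IsOpen I) (h0 : (0 : ℝ) ∈ I) {φ : ℝ → ℝ}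
    (h : ∀ s ∈ I, Tendsto (fun i => laplace (μ i) s) atTop (𝓝 (ENNReal.ofReal (φ s)))) :
    ∃ ν : ProbabilityMeasure ℝ, Tendsto μ atTop (𝓝 ν) ∧
      ∀ s ∈ I, laplace ν s = ENNReal.ofReal (φ s) := by
  obtain ⟨δ, hδ, hball⟩ := Metric.isOpen_iff.1 hI 0 h0
  have h1 : -(δ / 2) ∈ I := hball (by simp [abs_of_pos hδ, hδ])
  have h2 : δ / 2 ∈ I := hball (by simp [abs_of_pos hδ, hδ])
  have hsum := (h _ h1).add (h _ h2)
  set C : ℝ≥0∞ := ENNReal.ofReal (φ (-(δ / 2))) + ENNReal.ofReal (φ (δ / 2)) + 1 with hCdef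
  have hC : C ≠ ∞ := by simp [hCdef]
  have hbd := hsum.eventually_le_const (u := C) (ENNReal.lt_add_right (by simp) (by simp))
  -- Markov's inequality for e^{-δx/2} + e^{δx/2}, whose integrals are eventually at most C, bounds
  -- both tails by C e^{-δr/2}.
  have htight : IsTightMeasureSet (Set.range fun n => (μ n : Measure ℝ)) := by
    refine isTightMeasureSet_range_of_tendsto_limsup_measure_norm_gt ?_
    have hle : ∀ r : ℝ, limsup (fun n => (μ n : Measure ℝ) {x | r < ‖x‖}) atTop ≤
        ENNReal.ofReal (Real.exp (-(δ / 2 * r))) * C := by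
      intro r
      refine limsup_le_of_le (by isBoundedDefault) (hbd.mono fun n hn => ?_)
      have hmk := mul_meas_ge_le_lintegral₀ (μ := (μ n : Measure ℝ))
        (f := fun x => ENNReal.ofReal (Real.exp (-(δ / 2) * x) + Real.exp (δ / 2 * x)))
        (by fun_prop) (ENNReal.ofReal (Real.exp (δ / 2 * r)))
      rw [lintegral_exp_add_exp] at hmk
      have hsub : {x : ℝ | r < ‖x‖} ⊆ {x | ENNReal.ofReal (Real.exp (δ / 2 * r)) ≤
          ENNReal.ofReal (Real.exp (-(δ / 2) * x) + Real.exp (δ / 2 * x))} := by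
        intro x hx
        simp only [mem_ofPred_eq, Real.norm_eq_abs] at hx ⊢
        refine ENNReal.ofReal_le_ofReal ?_
        have e1 := Real.exp_pos (-(δ / 2) * x)
        have e2 := Real.exp_pos (δ / 2 * x)
        rcases lt_abs.1 hx with hx | hx
        · have : Real.exp (δ / 2 * r) ≤ Real.exp (δ / 2 * x) := by gcongr
          linarith
        · have : Real.exp (δ / 2 * r) ≤ Real.exp (-(δ / 2) * x) := by
            apply Real.exp_le_exp.2; nlinarith
          linarith
      calc (μ n : Measure ℝ) {x | r < ‖x‖}
          = ENNReal.ofReal (Real.exp (-(δ / 2 * r))) *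
            (ENNReal.ofReal (Real.exp (δ / 2 * r)) * (μ n : Measure ℝ) {x | r < ‖x‖}) := by
              rw [← mul_assoc, ← ENNReal.ofReal_mul (by positivity), ← Real.exp_add]
              simp
        _ ≤ _ := by
            gcongr
            exact ((mul_le_mul_right (measure_mono hsub) _).trans hmk).trans hn
    refine tendsto_of_tendsto_of_tendsto_of_le_of_le tendsto_const_nhds ?_ (fun _ => zero_le) hle
    have : Tendsto (fun r : ℝ => Real.exp (-(δ / 2 * r))) atTop (𝓝 0) :=
      Real.tendsto_exp_neg_atTop_nhds_zero.comp (tendsto_id.const_mul_atTop (half_pos hδ))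
    have := ENNReal.tendsto_ofReal this
    simpa using ENNReal.Tendsto.mul_const this (Or.inr hC)
  have hcomp : IsCompact (closure (Set.range μ)) := by
    refine isCompact_closure_of_isTightMeasureSet ?_
    convert htight using 1
    ext m
    simp
  -- By compactness every ultrafilter finer than `atTop` has a limit, and its transform on I must be
  -- φ. Uniqueness makes all these limits equal, so the whole sequence converges.
  have hlim (U : Ultrafilter ℕ) (hU : (U : Filter ℕ) ≤ atTop) : ∃ ν : ProbabilityMeasure ℝ,
      Tendsto μ U (𝓝 ν) ∧ ∀ s ∈ I, laplace ν s = ENNReal.ofReal (φ s) := by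
    obtain ⟨ν, -, hν⟩ := hcomp.ultrafilter_le_nhds (U.map μ)
      (by
        rw [Filter.le_principal_iff]
        exact Filter.mem_of_superset (Filter.range_mem_map) subset_closure)
    exact ⟨ν, hν, fun s hs => tendsto_laplace_of_tendsto hν hI
      (fun s hs => (h s hs).mono_left hU) hs⟩
  obtain ⟨ν, -, hν⟩ := hlim (hyperfilter ℕ) Nat.hyperfilter_le_atTop
  refine ⟨ν, (tendsto_iff_ultrafilter _ _ _).2 fun U hU => ?_, hν⟩
  obtain ⟨ν', hν', hν'I⟩ := hlim U hU
  have : ν' = ν := ext_of_laplace_eq hI h0 (fun s hs => by simp [hν'I s hs])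
    fun s hs => by rw [hν'I s hs, hν s hs]
  rwa [← this]

/-! ### Compound laws and infinite divisibility -/

theorem laplace_conv (μ ν : Measure ℝ) [SFinite ν] (s : ℝ) :
    laplace (μ.conv ν) s = laplace μ s * laplace ν s := by
  unfold laplace
  rw [Measure.lintegral_conv (by fun_prop), ← lintegral_mul_const _ (by fun_prop)]
  refine lintegral_congr fun x => ?_
  rw [← lintegral_const_mul _ (by fun_prop)]
  refine lintegral_congr fun y => ?_
  rw [← ENNReal.ofReal_mul (by positivity), ← Real.exp_add, mul_add]

/-- The `j`-fold convolution power of a measure on the line. -/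
noncomputable def convPow (Φ : Measure ℝ) : ℕ → Measure ℝ
  | 0 => Measure.dirac 0
  | j + 1 => Φ.conv (convPow Φ j)

instance convPow_isFiniteMeasure (Φ : Measure ℝ) [IsFiniteMeasure Φ] (j : ℕ) :
    IsFiniteMeasure (convPow Φ j) := by
  induction j with
  | zero => unfold convPow; infer_instance
  | succ j ih => unfold convPow; infer_instance

theorem laplace_convPow (Φ : Measure ℝ) [IsFiniteMeasure Φ] (j : ℕ) (s : ℝ) :
    laplace (convPow Φ j) s = laplace Φ s ^ j := by
  induction j with
  | zero => simp [convPow, laplace]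
  | succ j ih => rw [convPow, laplace_conv, ih, pow_succ']

/-- Up to the factor j! this is α(α + 1)⋯(α + j - 1). -/
theorem multichoose_nonneg {α : ℝ} (hα : 0 < α) (j : ℕ) : 0 ≤ Ring.multichoose α j := by
  have h := Ring.factorial_nsmul_multichoose_eq_ascPochhammer α j
  rw [Polynomial.ascPochhammer_smeval_eq_eval] at h
  have h2 := ascPochhammer_pos j α hα
  rw [← h, nsmul_eq_mul] at h2
  exact (pos_of_mul_pos_right h2 (by positivity)).le

/-- This is the binomial series of (1 - a)^{-α}, whose coefficients are the unnormalised negative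
binomial weights. -/
theorem hasSum_multichoose_mul_pow {α a : ℝ} (ha0 : 0 ≤ a) (ha1 : a < 1) :
    HasSum (fun j => Ring.multichoose α j * a ^ j) (((1 - a)⁻¹) ^ α) := by
  have h := (Real.one_div_one_sub_rpow_hasFPowerSeriesOnBall_zero α).hasSum (y := a)
    (by simp [enorm_eq_nnnorm, ← NNReal.coe_lt_coe, abs_of_nonneg ha0, ha1])
  rw [zero_add, one_div, ← Real.inv_rpow (by linarith)] at h
  refine h.congr_fun fun j => ?_
  rw [FormalMultilinearSeries.ofScalars_apply_eq, Ring.choose, smul_eq_mul]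
  congr 2
  ring

/-- The compound law with negative binomial weights: if `Φ` has mass `1 - q`, there is a law whose
Laplace transform is the `α`-th power of that of the geometric compound of `Φ`. -/
theorem exists_laplace_eq_rpow (Φ : Measure ℝ) [IsFiniteMeasure Φ] {q α : ℝ} (hq : 0 < q)
    (hq1 : q ≤ 1) (hα : 0 < α) (hΦ : Φ univ = ENNReal.ofReal (1 - q)) :
    ∃ κ : ProbabilityMeasure ℝ, ∀ s a : ℝ, 0 ≤ a → a < 1 → laplace Φ s = ENNReal.ofReal a →
      laplace κ s = ENNReal.ofReal ((q / (1 - a)) ^ α) := by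
  set κ : Measure ℝ := Measure.sum fun j =>
    ENNReal.ofReal (q ^ α * Ring.multichoose α j) • convPow Φ j with hκ
  have key : ∀ s a : ℝ, 0 ≤ a → a < 1 → laplace Φ s = ENNReal.ofReal a →
      laplace κ s = ENNReal.ofReal ((q / (1 - a)) ^ α) := by
    intro s a ha0 ha1 ha
    have hs := (hasSum_multichoose_mul_pow (α := α) ha0 ha1).mul_left (q ^ α)
    have hnn : ∀ j, 0 ≤ q ^ α * (Ring.multichoose α j * a ^ j) := fun j =>
      mul_nonneg (by positivity) (mul_nonneg (multichoose_nonneg hα j) (by positivity))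
    rw [div_eq_mul_inv, Real.mul_rpow hq.le (inv_nonneg.2 (by linarith)), ← hs.tsum_eq,
      ENNReal.ofReal_tsum_of_nonneg hnn hs.summable, hκ, laplace, lintegral_sum_measure]
    refine tsum_congr fun j => ?_
    rw [lintegral_smul_measure, ← mul_assoc, ENNReal.ofReal_mul
      (mul_nonneg (by positivity) (multichoose_nonneg hα j)), ENNReal.ofReal_pow ha0, ← ha,
      ← laplace_convPow]
    rfl
  -- The total mass is the transform at s = 0, where a = 1 - q and the formula gives (q / q)^α = 1.
  have h1 : κ univ = 1 := by
    have h0 := key 0 (1 - q) (by linarith) (by linarith) (by simp [laplace, hΦ])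
    simpa [laplace, hq.ne'] using h0
  exact ⟨⟨κ, ⟨h1⟩⟩, key⟩

theorem laplace_map_sum_pi (κ : ProbabilityMeasure ℝ) (n : ℕ) (s : ℝ) :
    laplace ((Measure.pi fun _ : Fin n => (κ : Measure ℝ)).map (fun x => ∑ i, x i)) s =
      laplace κ s ^ n := by
  unfold laplace
  rw [lintegral_map (by fun_prop) (by fun_prop)]
  have hind : iIndepFun (fun (i : Fin n) (ω : Fin n → ℝ) =>
      ENNReal.ofReal (Real.exp (s * ω i))) (Measure.pi fun _ : Fin n => (κ : Measure ℝ)) :=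
    iIndepFun_pi (X := fun _ x => ENNReal.ofReal (Real.exp (s * x)))
      (fun i => by fun_prop)
  have h := lintegral_prod_eq_prod_lintegral_of_indepFun Finset.univ _ hind
    (fun i => by fun_prop)
  simp_rw [Finset.mul_sum, Real.exp_sum]
  simp_rw [ENNReal.ofReal_prod_of_nonneg (fun i _ => (Real.exp_pos _).le)]
  rw [h]
  have hi : ∀ i : Fin n, ∫⁻ ω, ENNReal.ofReal (Real.exp (s * ω i))
      ∂(Measure.pi fun _ : Fin n => (κ : Measure ℝ)) =
      ∫⁻ x, ENNReal.ofReal (Real.exp (s * x)) ∂(κ : Measure ℝ) := fun i =>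
    (measurePreserving_eval (fun _ : Fin n => (κ : Measure ℝ)) i).lintegral_comp
      (f := fun x => ENNReal.ofReal (Real.exp (s * x))) (by fun_prop)
  simp [hi]

/-- A law is infinitely divisible if all roots of its Laplace transform near `0` are Laplace
transforms of laws. -/
theorem isInfinitelyDivisible_of_laplace_rpow {ν : ProbabilityMeasure ℝ} {I : Set ℝ}
    (hI : IsOpen I) (h0 : (0 : ℝ) ∈ I) {φ : ℝ → ℝ} (hφ : ∀ s ∈ I, 0 ≤ φ s)
    (hν : ∀ s ∈ I, laplace ν s = ENNReal.ofReal (φ s))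
    (h : ∀ n : ℕ, 1 ≤ n → ∃ κ : ProbabilityMeasure ℝ, ∀ s ∈ I,
      laplace κ s = ENNReal.ofReal (φ s ^ (1 / (n : ℝ)))) :
    IsInfinitelyDivisible ν := by
  intro n hn
  obtain ⟨κ, hκ⟩ := h n hn
  refine ⟨κ, ?_⟩
  have hprob : IsProbabilityMeasure
      ((Measure.pi fun _ : Fin n => (κ : Measure ℝ)).map (fun x => ∑ i, x i)) :=
    Measure.isProbabilityMeasure_map (by fun_prop)
  have := ext_of_laplace_eq (μ := ⟨_, hprob⟩) (ν := ν) hI h0 ?_ ?_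
  · exact congrArg Subtype.val this
  · intro s hs
    change laplace ((Measure.pi fun _ : Fin n => (κ : Measure ℝ)).map (fun x => ∑ i, x i)) s < ∞
    rw [laplace_map_sum_pi, hκ s hs]
    simp
  · intro s hs
    change laplace ((Measure.pi fun _ : Fin n => (κ : Measure ℝ)).map (fun x => ∑ i, x i)) s = _
    rw [laplace_map_sum_pi, hκ s hs, hν s hs, ← ENNReal.ofReal_pow
      (Real.rpow_nonneg (hφ s hs) _), ← Real.rpow_natCast, ← Real.rpow_mul (hφ s hs)]
    rw [one_div, inv_mul_cancel₀ (by positivity), Real.rpow_one]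

theorem laplace_map_const_add (μ : Measure ℝ) (c s : ℝ) :
    laplace (μ.map (fun x => c + x)) s = ENNReal.ofReal (Real.exp (s * c)) * laplace μ s := by
  unfold laplace
  rw [lintegral_map (by fun_prop) (by fun_prop), ← lintegral_const_mul _ (by fun_prop)]
  refine lintegral_congr fun x => ?_
  rw [← ENNReal.ofReal_mul (by positivity), ← Real.exp_add, mul_add]

/-! ### The law of the lifetime -/

/-- The walker is in the interior without energy. -/
def IsDead (N : ℕ) (z : State) : Prop := 0 < z.1 ∧ z.1 < N ∧ z.2 = 0

instance (N : ℕ) : DecidablePred (IsDead N) := fun z => by unfold IsDead; infer_instance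

/-- The transition operator of the chain killed at death. -/
noncomputable def aliveStep (N M : ℕ) (g : State → ℝ≥0∞) (z : State) : ℝ≥0∞ :=
  if IsDead N z then 0 else ∫⁻ y, g y ∂(stepLaw N M z)

/-- The probability that the lifetime of the walk started at `z` equals `n`. -/
noncomputable def lifetimeProb (N M n : ℕ) : State → ℝ≥0∞ :=
  (aliveStep N M)^[n] fun z => if IsDead N z then 1 else 0

theorem lifetimeProb_zero (N M : ℕ) (z : State) :
    lifetimeProb N M 0 z = if IsDead N z then 1 else 0 := rfl

theorem lifetimeProb_succ (N M n : ℕ) (z : State) :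
    lifetimeProb N M (n + 1) z =
      if IsDead N z then 0 else ∫⁻ y, lifetimeProb N M n y ∂(stepLaw N M z) := by
  rw [lifetimeProb, Function.iterate_succ_apply']
  rfl

theorem lintegral_chainLaw_zero (N M : ℕ) (z : State) (g : State → ℝ≥0∞) :
    ∫⁻ ζ, g (ζ 0) ∂(chainLaw N M z) = g z := by
  have hg : Measurable g := Measurable.of_discrete
  have h : (chainLaw N M z).map (Preorder.frestrictLe (π := fun _ => State) 0) =
      (Measure.dirac z).map (MeasurableEquiv.piUnique
        (fun _ : Finset.Iic 0 => State)).symm := by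
    unfold chainLaw Kernel.trajMeasure
    rw [Measure.map_comp _ _ (by fun_prop), Kernel.traj_map_frestrictLe,
      Kernel.partialTraj_self, Measure.id_comp]
  have h2 := congrArg (fun m => ∫⁻ x, g (x ⟨0, by simp⟩) ∂m) h
  beta_reduce at h2
  rw [lintegral_map (by fun_prop) (by fun_prop), lintegral_map (by fun_prop) (by fun_prop),
    lintegral_dirac' _ (by fun_prop)] at h2
  exact h2

/-- The Markov property for the chain killed at death: integrating out the last coordinate replaces
g by `aliveStep N M g`, which is why g varies in the induction. -/
theorem lintegral_chainLaw_prod (N M : ℕ) (z : State) (n : ℕ) (g : State → ℝ≥0∞) :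
    ∫⁻ ζ, (∏ k ∈ Finset.range n, if IsDead N (ζ k) then 0 else 1) * g (ζ n)
      ∂(chainLaw N M z) = (aliveStep N M)^[n] g z := by
  have hg' : ∀ g : State → ℝ≥0∞, Measurable g := fun g => Measurable.of_discrete
  induction n generalizing g with
  | zero => simpa using lintegral_chainLaw_zero N M z g
  | succ n ih =>
    rw [Function.iterate_succ_apply, ← ih]
    set α : State → ℝ≥0∞ := fun y => if IsDead N y then 0 else 1 with hα
    have hαm := hg' α
    have hgm := hg' g
    have hTm := hg' (aliveStep N M g)
    -- The joint law of the history up to n and the state at n + 1 is the law of the history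
    -- composed with the step kernel.
    have hjoint := Kernel.map_frestrictLe_trajMeasure_compProd_eq_map_trajMeasure
      (X := fun _ => State) (μ₀ := Measure.dirac z)
      (κ := fun n => (stepKernel N M).comap
      (fun h : (i : Finset.Iic n) → State => h ⟨n, Finset.mem_Iic.2 le_rfl⟩)
      (measurable_pi_apply _)) (a := n)
    have h2 := congrArg (fun m => ∫⁻ p : ((i : Finset.Iic n) → State) × State,
      (∏ k : Finset.Iic n, α (p.1 k)) * g p.2 ∂m) hjoint
    beta_reduce at h2
    rw [Measure.lintegral_compProd (by fun_prop), lintegral_map (by fun_prop) (by fun_prop),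
      lintegral_map (by fun_prop) (by fun_prop)] at h2
    have hprod : ∀ ζ : ℕ → State, ∏ k : Finset.Iic n, α (Preorder.frestrictLe
        (π := fun _ => State) n ζ k) = ∏ k ∈ Finset.range (n + 1), α (ζ k) := by
      intro ζ
      rw [Nat.range_succ_eq_Iic]
      exact Finset.prod_coe_sort (Finset.Iic n) (fun k => α (ζ k))
    simp_rw [hprod] at h2
    change _ = ∫⁻ ζ, _ ∂(chainLaw N M z) at h2
    rw [← h2]
    refine lintegral_congr fun ζ => ?_
    rw [lintegral_const_mul _ hgm, Finset.prod_range_succ, mul_assoc]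
    congr 1
    simp only [hα, aliveStep]
    split_ifs
    · simp
    · simp; rfl

theorem lifetime_eq_coe_iff (N : ℕ) (ζ : ℕ → State) (n : ℕ) :
    lifetime N ζ = n ↔ (∀ k < n, ¬ IsDead N (ζ k)) ∧ IsDead N (ζ n) := by
  have hl : lifetime N ζ = ⨅ k ∈ {k : ℕ | IsDead N (ζ k)}, (k : ℕ∞) := sInf_image
  rcases Set.eq_empty_or_nonempty {k : ℕ | IsDead N (ζ k)} with he | hne
  · have hno : ∀ k, ¬ IsDead N (ζ k) := fun k hk => by
      have : k ∈ {k : ℕ | IsDead N (ζ k)} := hk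
      simp [he] at this
    rw [hl, he]
    simp [hno]
  · rw [hl, ← ENat.natCast_sInf hne, Nat.cast_inj]
    constructor
    · rintro rfl
      exact ⟨fun k hk hd => absurd (Nat.sInf_le hd) (not_le.2 hk), Nat.sInf_mem hne⟩
    · rintro ⟨h1, h2⟩
      refine le_antisymm (Nat.sInf_le h2) ?_
      by_contra hlt
      exact h1 _ (not_le.1 hlt) (Nat.sInf_mem hne)

theorem measurableSet_isDead (N n : ℕ) : MeasurableSet {ζ : ℕ → State | IsDead N (ζ n)} := by
  have h : Measurable (fun ζ : ℕ → State => ζ n) := measurable_pi_apply n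
  exact h (MeasurableSet.of_discrete (s := {z : State | IsDead N z}))

theorem measurableSet_lifetime_eq (N n : ℕ) :
    MeasurableSet {ζ : ℕ → State | lifetime N ζ = n} := by
  have : {ζ : ℕ → State | lifetime N ζ = n} =
      (⋂ k : ℕ, ⋂ _ : k < n, {ζ : ℕ → State | IsDead N (ζ k)}ᶜ) ∩ {ζ | IsDead N (ζ n)} := by
    ext ζ
    simp [lifetime_eq_coe_iff]
  rw [this]
  refine MeasurableSet.inter ?_ (measurableSet_isDead N n)
  exact MeasurableSet.iInter fun k => MeasurableSet.iInter fun _ => (measurableSet_isDead N k).compl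

theorem measurable_lifetime (N : ℕ) : Measurable (lifetime N) := by
  refine measurable_to_countable' fun x => ?_
  induction x with
  | top =>
    have : lifetime N ⁻¹' {⊤} = (⋃ n : ℕ, {ζ : ℕ → State | lifetime N ζ = n})ᶜ := by
      ext ζ
      simp only [mem_preimage, mem_singleton_iff, mem_compl_iff, mem_iUnion, mem_ofPred_eq]
      constructor
      · rintro h ⟨n, hn⟩
        simp [h] at hn
      · intro h
        by_contra h'
        obtain ⟨n, hn⟩ := ENat.ne_top_iff_exists.1 h'
        exact h ⟨n, hn.symm⟩
    rw [this]
    exact (MeasurableSet.iUnion fun n => measurableSet_lifetime_eq N n).compl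
  | coe n => exact measurableSet_lifetime_eq N n

theorem chainLaw_lifetime_eq (N M : ℕ) (z : State) (n : ℕ) :
    chainLaw N M z {ζ | lifetime N ζ = n} = lifetimeProb N M n z := by
  classical
  rw [← lintegral_indicator_one (measurableSet_lifetime_eq N n), lifetimeProb,
    ← lintegral_chainLaw_prod]
  refine lintegral_congr fun ζ => ?_
  by_cases h : (∀ k < n, ¬ IsDead N (ζ k)) ∧ IsDead N (ζ n)
  · rw [indicator_of_mem (by simpa [lifetime_eq_coe_iff] using h), Finset.prod_eq_one, if_pos h.2]
    · simp
    · intro k hk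
      rw [if_neg (h.1 k (Finset.mem_range.1 hk))]
  · rw [indicator_of_notMem (by simpa [lifetime_eq_coe_iff] using h)]
    by_cases hd : IsDead N (ζ n)
    · simp only [hd, and_true] at h
      push Not at h
      obtain ⟨k, hk, hdk⟩ := h
      rw [Finset.prod_eq_zero (i := k) (Finset.mem_range.2 hk) (by rw [if_pos hdk]), zero_mul]
    · simp [hd]

/-- Expectations of functions of an almost surely finite lifetime. -/
theorem lintegral_lifetime {N M : ℕ} {z : State}
    (h : ∑' n, lifetimeProb N M n z = 1) :
    (∀ᵐ ζ ∂(chainLaw N M z), lifetime N ζ ≠ ⊤) ∧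
    ∀ W : ℕ∞ → ℝ≥0∞, ∫⁻ ζ, W (lifetime N ζ) ∂(chainLaw N M z) =
      ∑' n : ℕ, lifetimeProb N M n z * W n := by
  have hmeas := fun n => measurableSet_lifetime_eq N n
  have hdisj : Pairwise (Function.onFun Disjoint
      fun n : ℕ => {ζ : ℕ → State | lifetime N ζ = n}) := by
    intro a b hab
    refine Set.disjoint_left.2 fun ζ ha hb => hab ?_
    have ha' : lifetime N ζ = a := ha
    have hb' : lifetime N ζ = b := hb
    exact_mod_cast ha'.symm.trans hb'
  have hU : chainLaw N M z (⋃ n : ℕ, {ζ : ℕ → State | lifetime N ζ = n}) = 1 := by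
    rw [measure_iUnion hdisj hmeas]
    simp_rw [chainLaw_lifetime_eq]
    exact h
  have hae : ∀ᵐ ζ ∂(chainLaw N M z), ζ ∈ ⋃ n : ℕ, {ζ : ℕ → State | lifetime N ζ = n} :=
    (mem_ae_iff_prob_eq_one (MeasurableSet.iUnion hmeas)).2 hU
  refine ⟨?_, fun W => ?_⟩
  · filter_upwards [hae] with ζ hζ
    obtain ⟨n, hn⟩ := mem_iUnion.1 hζ
    have hn' : lifetime N ζ = n := hn
    simp [hn']
  · rw [← Measure.restrict_eq_self_of_ae_mem hae, lintegral_iUnion hmeas hdisj]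
    refine tsum_congr fun n => ?_
    rw [setLIntegral_congr_fun (hmeas n) (g := fun _ => W n)
      (fun ζ hζ => by
        have hζ' : lifetime N ζ = n := hζ
        simp [hζ']), setLIntegral_const, chainLaw_lifetime_eq, mul_comm]

/-! ### The generating function of the lifetime -/

theorem lintegral_stepLaw (N M : ℕ) (x : ℤ) (i : ℕ) (g : State → ℝ≥0∞) :
    ∫⁻ y, g y ∂(stepLaw N M (x, i)) =
      if x = 0 then g (1, M) else if x = N then g ((N : ℤ) - 1, M)
      else match i with
        | 0 => g (x, 0)
        | i + 1 => 2⁻¹ * g (x + 1, i) + 2⁻¹ * g (x - 1, i) := by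
  have hg : Measurable g := Measurable.of_discrete
  unfold stepLaw
  simp only
  split_ifs
  · rw [lintegral_dirac' _ hg]
  · rw [lintegral_dirac' _ hg]
  · cases i with
    | zero => simp only; rw [lintegral_dirac' _ hg]
    | succ i =>
      simp only
      rw [lintegral_add_measure, lintegral_smul_measure, lintegral_smul_measure,
        lintegral_dirac' _ hg, lintegral_dirac' _ hg]
      rfl

/-- Reflection exchanges the two refreshed states (1, M) and (N - 1, M), so a single renewal state
suffices. -/
theorem lifetimeProb_reflect {N M : ℕ} (hN : 2 ≤ N) (n : ℕ) (x : ℤ) (i : ℕ) :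
    lifetimeProb N M n (N - x, i) = lifetimeProb N M n (x, i) := by
  induction n generalizing x i with
  | zero =>
    rw [lifetimeProb_zero, lifetimeProb_zero]
    congr 1
    simp only [IsDead, eq_iff_iff]
    omega
  | succ n ih =>
    rw [lifetimeProb_succ, lifetimeProb_succ, lintegral_stepLaw, lintegral_stepLaw]
    have hd : IsDead N ((N : ℤ) - x, i) ↔ IsDead N (x, i) := by
      simp only [IsDead]; omega
    rw [if_congr hd rfl rfl]
    by_cases h : IsDead N (x, i)
    · simp [h]
    · rw [if_neg h, if_neg h]
      by_cases hx : x = 0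
      · subst hx
        have h1 : ¬ ((N : ℤ) = 0) := by omega
        simp only [sub_zero, h1, if_false, if_true]
        exact ih 1 M
      · by_cases hxN : x = N
        · subst hxN
          simp only [sub_self, if_true, hx, if_false]
          exact (ih 1 M).symm
        · rw [if_neg hx, if_neg hxN, if_neg (by omega), if_neg (by omega)]
          cases i with
          | zero => exact ih x 0
          | succ i =>
            simp only
            rw [show (N : ℤ) - x + 1 = N - (x - 1) by ring,
              show (N : ℤ) - x - 1 = N - (x + 1) by ring, ih, ih, add_comm]

theorem lifetimeProb_le_one (N M n : ℕ) (z : State) : lifetimeProb N M n z ≤ 1 := by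
  rw [← chainLaw_lifetime_eq]
  exact prob_le_one

/-- Partial sums of the generating function `∑ P_z(λ = n) w ^ n`. -/
noncomputable def genFun (N M : ℕ) (w : ℝ≥0∞) (K : ℕ) (z : State) : ℝ≥0∞ :=
  ∑ n ∈ Finset.range K, lifetimeProb N M n z * w ^ n

theorem genFun_succ (N M : ℕ) (w : ℝ≥0∞) (K : ℕ) (z : State) :
    genFun N M w (K + 1) z =
      if IsDead N z then 1 else w * ∫⁻ y, genFun N M w K y ∂(stepLaw N M z) := by
  unfold genFun
  rw [Finset.sum_range_succ', lifetimeProb_zero]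
  simp_rw [lifetimeProb_succ]
  split_ifs with h
  · simp
  · rw [lintegral_finsetSum _ (fun n _ => Measurable.of_discrete), Finset.mul_sum]
    simp only [zero_mul, add_zero]
    refine Finset.sum_congr rfl fun n _ => ?_
    rw [lintegral_mul_const _ Measurable.of_discrete, pow_succ]
    ring

theorem genFun_mono (N M : ℕ) (w : ℝ≥0∞) (z : State) : Monotone fun K => genFun N M w K z :=
  fun _ _ h => Finset.sum_le_sum_of_subset (Finset.range_mono h)

theorem genFun_ne_top (N M : ℕ) {w : ℝ≥0∞} (hw : w ≠ ∞) (K : ℕ) (z : State) :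
    genFun N M w K z ≠ ∞ := by
  refine (ENNReal.sum_lt_top.2 fun n _ => ?_).ne
  exact ENNReal.mul_lt_top ((lifetimeProb_le_one N M n z).trans_lt ENNReal.one_lt_top)
    (ENNReal.pow_lt_top hw.lt_top)

theorem genFun_reflect {N M : ℕ} (hN : 2 ≤ N) (w : ℝ≥0∞) (K : ℕ) (x : ℤ) (i : ℕ) :
    genFun N M w K (N - x, i) = genFun N M w K (x, i) := by
  simp_rw [genFun, lifetimeProb_reflect hN]

/-! ### Survival of simple random walk and the renewal equation. -/

/-- The probability that simple random walk started at `x` stays in `{1, …, N - 1}` during its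
first `n` steps. -/
noncomputable def surv (N : ℕ) : ℕ → ℤ → ℝ
  | 0, x => if 0 < x ∧ x < N then 1 else 0
  | n + 1, x => if 0 < x ∧ x < N then (surv N n (x + 1) + surv N n (x - 1)) / 2 else 0

theorem surv_of_not_mem {N : ℕ} {x : ℤ} (hx : ¬ (0 < x ∧ x < N)) (n : ℕ) : surv N n x = 0 := by
  cases n <;> simp [surv, hx]

theorem surv_succ {N : ℕ} {x : ℤ} (hx : 0 < x ∧ x < N) (n : ℕ) :
    surv N (n + 1) x = (surv N n (x + 1) + surv N n (x - 1)) / 2 := by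
  simp [surv, hx]

theorem surv_zero {N : ℕ} {x : ℤ} (hx : 0 < x ∧ x < N) : surv N 0 x = 1 := by
  simp [surv, hx]

theorem surv_nonneg (N n : ℕ) (x : ℤ) : 0 ≤ surv N n x := by
  induction n generalizing x with
  | zero => simp only [surv]; split_ifs <;> simp
  | succ n ih =>
    simp only [surv]
    split_ifs
    · linarith [ih (x + 1), ih (x - 1)]
    · rfl

theorem surv_zero_le_one (N : ℕ) (x : ℤ) : surv N 0 x ≤ 1 := by
  simp only [surv]; split_ifs <;> simp

theorem surv_succ_le (N n : ℕ) (x : ℤ) : surv N (n + 1) x ≤ surv N n x := by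
  by_cases hx : 0 < x ∧ x < N
  · induction n generalizing x with
    | zero =>
      rw [surv_succ hx, surv_zero hx]
      linarith [surv_zero_le_one N (x + 1), surv_zero_le_one N (x - 1)]
    | succ n ih =>
      have h : ∀ y, surv N (n + 1) y ≤ surv N n y := fun y => by
        by_cases hy : 0 < y ∧ y < N
        · exact ih y hy
        · rw [surv_of_not_mem hy, surv_of_not_mem hy]
      rw [surv_succ hx, surv_succ hx]
      linarith [h (x + 1), h (x - 1)]
  · rw [surv_of_not_mem hx, surv_of_not_mem hx]

theorem surv_antitone (N : ℕ) (x : ℤ) : Antitone fun n => surv N n x :=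
  antitone_nat_of_succ_le fun n => surv_succ_le N n x

theorem surv_le_one (N n : ℕ) (x : ℤ) : surv N n x ≤ 1 :=
  (surv_antitone N x (Nat.zero_le n)).trans (surv_zero_le_one N x)

/-- The generating function `E_x[w ^ (τ + 1); τ ≤ i]` of the hitting time `τ` of `{0, N}`, for `x`
in `{0, …, N}`. -/
noncomputable def hitGen (N : ℕ) (w : ℝ) (i : ℕ) (x : ℤ) : ℝ :=
  (if x = 0 ∨ x = N then w else 0) +
    ∑ k ∈ Finset.range i, (surv N k x - surv N (k + 1) x) * w ^ (k + 2)

theorem hitGen_nonneg (N : ℕ) {w : ℝ} (hw : 0 ≤ w) (i : ℕ) (x : ℤ) : 0 ≤ hitGen N w i x := by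
  unfold hitGen
  have : ∀ k, 0 ≤ (surv N k x - surv N (k + 1) x) * w ^ (k + 2) := fun k =>
    mul_nonneg (by linarith [surv_succ_le N k x]) (by positivity)
  refine add_nonneg (by split_ifs <;> simp [hw]) (Finset.sum_nonneg fun k _ => this k)

theorem hitGen_boundary {N : ℕ} (w : ℝ) (i : ℕ) {x : ℤ} (hx : x = 0 ∨ x = N) :
    hitGen N w i x = w := by
  have h : ¬ (0 < x ∧ x < N) := by omega
  simp [hitGen, hx, surv_of_not_mem h]

theorem hitGen_succ {N : ℕ} (w : ℝ) (i : ℕ) {x : ℤ} (hx : 0 < x ∧ x < N) :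
    hitGen N w (i + 1) x = w / 2 * (hitGen N w i (x + 1) + hitGen N w i (x - 1)) := by
  unfold hitGen
  have h0 : ¬ (x = 0 ∨ x = N) := by omega
  -- A neighbour of x may be a boundary site; in this form its boundary term supplies the k = 0
  -- summand at x.
  have hb : ∀ y : ℤ, 0 ≤ y → y ≤ N → (if y = 0 ∨ y = N then w else 0) = w * (1 - surv N 0 y) := by
    intro y hy0 hyN
    by_cases hy : y = 0 ∨ y = N
    · have : ¬ (0 < y ∧ y < N) := by omega
      simp [hy, surv_of_not_mem this]
    · rw [if_neg hy, surv_zero (by omega)]; ring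
  rw [hb (x + 1) (by omega) (by omega), hb (x - 1) (by omega) (by omega), if_neg h0,
    Finset.sum_range_succ', surv_zero hx, surv_succ hx]
  have : ∀ k, (surv N (k + 1) x - surv N (k + 1 + 1) x) * w ^ (k + 1 + 2) =
      w / 2 * ((surv N k (x + 1) - surv N (k + 1) (x + 1)) * w ^ (k + 2)) +
      w / 2 * ((surv N k (x - 1) - surv N (k + 1) (x - 1)) * w ^ (k + 2)) := by
    intro k
    rw [surv_succ hx, surv_succ hx]; ring
  simp_rw [this, Finset.sum_add_distrib, ← Finset.mul_sum]
  ring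

theorem ofReal_half_mul {w : ℝ} (hw : 0 ≤ w) {a b c d : ℝ} (ha : 0 ≤ a) (hb : 0 ≤ b) (hc : 0 ≤ c)
    (hd : 0 ≤ d) (u : ℝ≥0∞) :
    ENNReal.ofReal w * (2⁻¹ * (ENNReal.ofReal a * u + ENNReal.ofReal c) +
      2⁻¹ * (ENNReal.ofReal b * u + ENNReal.ofReal d)) =
    ENNReal.ofReal (w / 2 * (a + b)) * u + ENNReal.ofReal (w / 2 * (c + d)) := by
  have h2 : (2⁻¹ : ℝ≥0∞) = ENNReal.ofReal 2⁻¹ := by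
    rw [ENNReal.ofReal_inv_of_pos two_pos]; simp
  rw [h2, div_eq_mul_inv, ENNReal.ofReal_mul (by positivity), ENNReal.ofReal_mul hw,
    ENNReal.ofReal_mul (by positivity), ENNReal.ofReal_mul hw, ENNReal.ofReal_add ha hb,
    ENNReal.ofReal_add hc hd]
  ring

/-- The renewal equation alone is also solved by ∞. Truncated sums are finite, so the inequality
they satisfy can be solved for them, giving a bound uniform in K. -/
theorem genFun_le {N M : ℕ} (hN : 2 ≤ N) {w : ℝ} (hw : 0 ≤ w) (K : ℕ) {x : ℤ} (hx0 : 0 ≤ x)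
    (hxN : x ≤ N) (i : ℕ) :
    genFun N M (ENNReal.ofReal w) K (x, i) ≤
      ENNReal.ofReal (hitGen N w i x) * genFun N M (ENNReal.ofReal w) K (1, M) +
        ENNReal.ofReal (w ^ i * surv N i x) := by
  induction K generalizing x i with
  | zero => simp [genFun]
  | succ K ih =>
    have hmono : genFun N M (ENNReal.ofReal w) K (1, M) ≤
        genFun N M (ENNReal.ofReal w) (K + 1) (1, M) := genFun_mono N M _ _ (Nat.le_succ K)
    by_cases hb : x = 0 ∨ x = N
    · rw [hitGen_boundary w i hb]
      refine le_trans ?_ le_self_add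
      rw [genFun_succ, if_neg (by simp only [IsDead]; omega), lintegral_stepLaw]
      gcongr
      refine le_trans (le_of_eq ?_) hmono
      rcases hb with hb | hb
      · simp [hb]
      · have : ¬ ((N : ℤ) = 0) := by omega
        simp only [hb, this, if_false, if_true]
        exact genFun_reflect hN _ K 1 M
    · have hx : 0 < x ∧ x < N := by omega
      rw [genFun_succ, lintegral_stepLaw, if_neg (show x ≠ 0 by omega),
        if_neg (show x ≠ N by omega)]
      cases i with
      | zero =>
        rw [if_pos ⟨hx.1, hx.2, rfl⟩, surv_zero hx]
        simp
      | succ i =>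
        rw [if_neg (by simp [IsDead])]
        simp only
        have h1 := ih (x := x + 1) (by omega) (by omega) i
        have h2 := ih (x := x - 1) (by omega) (by omega) i
        calc _ ≤ _ := mul_le_mul_right (add_le_add (mul_le_mul_right h1 _)
                (mul_le_mul_right h2 _)) _
          _ = _ := ofReal_half_mul hw (hitGen_nonneg N hw _ _) (hitGen_nonneg N hw _ _)
                (mul_nonneg (by positivity) (surv_nonneg _ _ _))
                (mul_nonneg (by positivity) (surv_nonneg _ _ _)) _
          _ ≤ _ := by
            rw [← hitGen_succ w i hx, surv_succ hx,
              show w / 2 * (w ^ i * surv N i (x + 1) + w ^ i * surv N i (x - 1)) =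
              w ^ (i + 1) * ((surv N i (x + 1) + surv N i (x - 1)) / 2) by ring]
            gcongr

theorem tsum_lifetimeProb_eq_iSup (N M : ℕ) (w : ℝ≥0∞) (z : State) :
    ∑' n, lifetimeProb N M n z * w ^ n = ⨆ K, genFun N M w K z :=
  ENNReal.tsum_eq_iSup_nat

theorem tsum_lifetimeProb_recursion (N M : ℕ) (w : ℝ≥0∞) (z : State) :
    ∑' n, lifetimeProb N M n z * w ^ n = if IsDead N z then 1 else
      w * ∫⁻ y, ∑' n, lifetimeProb N M n y * w ^ n ∂(stepLaw N M z) := by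
  rw [tsum_eq_zero_add' ENNReal.summable, lifetimeProb_zero]
  simp_rw [lifetimeProb_succ]
  split_ifs with h
  · simp
  · rw [lintegral_tsum (fun n => Measurable.of_discrete.aemeasurable), ← ENNReal.tsum_mul_left]
    simp only [zero_mul, zero_add]
    refine tsum_congr fun n => ?_
    rw [lintegral_mul_const _ Measurable.of_discrete, pow_succ]
    ring

/-- Decomposition at min(τ, i): either the boundary is hit in time and the walk restarts from (1, M)
one step later, or it dies at time i. The identity holds in [0, ∞], by induction on the energy. -/
theorem tsum_lifetimeProb_renewal {N M : ℕ} (hN : 2 ≤ N) {w : ℝ} (hw : 0 ≤ w) (i : ℕ) {x : ℤ}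
    (hx0 : 0 ≤ x) (hxN : x ≤ N) :
    ∑' n, lifetimeProb N M n (x, i) * ENNReal.ofReal w ^ n =
      ENNReal.ofReal (hitGen N w i x) *
        (∑' n, lifetimeProb N M n (1, M) * ENNReal.ofReal w ^ n) +
        ENNReal.ofReal (w ^ i * surv N i x) := by
  induction i generalizing x with
  | zero =>
    by_cases hb : x = 0 ∨ x = N
    · rw [hitGen_boundary w 0 hb, surv_of_not_mem (by omega), tsum_lifetimeProb_recursion,
        if_neg (by simp only [IsDead]; omega), lintegral_stepLaw]
      simp only [mul_zero, ENNReal.ofReal_zero, add_zero]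
      congr 1
      rcases hb with hb | hb
      · simp [hb]
      · have : ¬ ((N : ℤ) = 0) := by omega
        simp only [hb, this, if_false, if_true]
        simp_rw [lifetimeProb_reflect hN _ 1 M]
    · have hx : 0 < x ∧ x < N := by omega
      rw [tsum_lifetimeProb_recursion, if_pos ⟨hx.1, hx.2, rfl⟩, surv_zero hx]
      simp [hitGen, hb]
  | succ i ih =>
    by_cases hb : x = 0 ∨ x = N
    · rw [hitGen_boundary w _ hb, surv_of_not_mem (by omega), tsum_lifetimeProb_recursion,
        if_neg (by simp only [IsDead]; omega), lintegral_stepLaw]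
      simp only [mul_zero, ENNReal.ofReal_zero, add_zero]
      congr 1
      rcases hb with hb | hb
      · simp [hb]
      · have : ¬ ((N : ℤ) = 0) := by omega
        simp only [hb, this, if_false, if_true]
        simp_rw [lifetimeProb_reflect hN _ 1 M]
    · have hx : 0 < x ∧ x < N := by omega
      rw [tsum_lifetimeProb_recursion, lintegral_stepLaw, if_neg (show x ≠ 0 by omega),
        if_neg (show x ≠ N by omega), if_neg (by simp [IsDead])]
      simp only
      rw [ih (x := x + 1) (by omega) (by omega), ih (x := x - 1) (by omega) (by omega),
        ofReal_half_mul hw (hitGen_nonneg N hw _ _) (hitGen_nonneg N hw _ _)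
          (mul_nonneg (by positivity) (surv_nonneg _ _ _))
          (mul_nonneg (by positivity) (surv_nonneg _ _ _)), ← hitGen_succ w i hx, surv_succ hx,
        show w / 2 * (w ^ i * surv N i (x + 1) + w ^ i * surv N i (x - 1)) =
          w ^ (i + 1) * ((surv N i (x + 1) + surv N i (x - 1)) / 2) by ring]

/-- The generating function of the lifetime of the walk started at `(1, M)`. -/
theorem tsum_lifetimeProb {N M : ℕ} (hN : 2 ≤ N) {w : ℝ} (hw : 0 ≤ w)
    (hA : hitGen N w M 1 < 1) :
    ∑' n, lifetimeProb N M n (1, M) * ENNReal.ofReal w ^ n =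
      ENNReal.ofReal (w ^ M * surv N M 1 / (1 - hitGen N w M 1)) := by
  set A := hitGen N w M 1 with hAdef
  set B := w ^ M * surv N M 1 with hBdef
  have hA0 : 0 ≤ A := hitGen_nonneg N hw M 1
  have hB0 : 0 ≤ B := mul_nonneg (by positivity) (surv_nonneg _ _ _)
  have h1A : 0 < 1 - A := by linarith
  set u := ∑' n, lifetimeProb N M n (1, M) * ENNReal.ofReal w ^ n with hu
  have hule : u ≤ ENNReal.ofReal (B / (1 - A)) := by
    rw [hu, tsum_lifetimeProb_eq_iSup]
    refine iSup_le fun K => ?_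
    have h := genFun_le (M := M) hN hw K (x := 1) (by norm_num) (by omega) M
    have hfin := genFun_ne_top N M (w := ENNReal.ofReal w) (by simp) K (1, M)
    rw [← ENNReal.ofReal_toReal hfin] at h ⊢
    set t := (genFun N M (ENNReal.ofReal w) K (1, M)).toReal with ht
    have ht0 : 0 ≤ t := ENNReal.toReal_nonneg
    rw [← ENNReal.ofReal_mul hA0, ← ENNReal.ofReal_add (by positivity) hB0,
      ENNReal.ofReal_le_ofReal_iff (by positivity)] at h
    refine ENNReal.ofReal_le_ofReal ?_
    rw [le_div_iff₀ h1A]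
    linarith
  have hfin : u ≠ ∞ := (hule.trans_lt (by simp)).ne
  have heq : u = ENNReal.ofReal A * u + ENNReal.ofReal B :=
    tsum_lifetimeProb_renewal hN hw M (by norm_num) (by omega)
  have hreal : u.toReal = A * u.toReal + B := by
    conv_lhs => rw [heq]
    rw [ENNReal.toReal_add (ENNReal.mul_ne_top (by simp) hfin) (by simp), ENNReal.toReal_mul,
      ENNReal.toReal_ofReal hA0, ENNReal.toReal_ofReal hB0]
  rw [← ENNReal.ofReal_toReal hfin]
  congr 1
  rw [eq_div_iff h1A.ne']
  linarith

theorem hitGen_one {N : ℕ} (hN : 2 ≤ N) (M : ℕ) : hitGen N 1 M 1 = 1 - surv N M 1 := by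
  have h0 : ¬ ((1 : ℤ) = 0 ∨ (1 : ℤ) = N) := by omega
  rw [hitGen, if_neg h0]
  simp only [one_pow, mul_one, zero_add]
  rw [Finset.sum_range_sub', surv_zero (by omega)]

/-- At w = 1 the generating function equals q / (1 - (1 - q)); each cycle ends in death with
probability q > 0. -/
theorem tsum_lifetimeProb_eq_one {N M : ℕ} (hN : 2 ≤ N) (hq : 0 < surv N M 1) :
    ∑' n, lifetimeProb N M n (1, M) = 1 := by
  have h := tsum_lifetimeProb (M := M) hN (w := 1) zero_le_one (by rw [hitGen_one hN]; linarith)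
  rw [hitGen_one hN] at h
  simpa [hq.ne'] using h

/-- The law, with total mass `P(τ ≤ M)`, of `(τ + 1) / M` on the event `τ ≤ M`, where `τ` is the
hitting time of `{0, N}` from `1`. -/
noncomputable def hitLaw (N M : ℕ) : Measure ℝ :=
  ∑ k ∈ Finset.range M, ENNReal.ofReal (surv N k 1 - surv N (k + 1) 1) •
    Measure.dirac (((k + 2 : ℕ) : ℝ) / M)

theorem laplace_hitLaw {N : ℕ} (hN : 2 ≤ N) (M : ℕ) (s : ℝ) :
    laplace (hitLaw N M) s = ENNReal.ofReal (hitGen N (Real.exp (s / M)) M 1) := by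
  have h0 : ¬ ((1 : ℤ) = 0 ∨ (1 : ℤ) = N) := by omega
  have hnn : ∀ k, 0 ≤ surv N k 1 - surv N (k + 1) 1 := fun k => by linarith [surv_succ_le N k 1]
  rw [hitGen, if_neg h0, zero_add, ENNReal.ofReal_sum_of_nonneg
    (fun k _ => mul_nonneg (hnn k) (by positivity)), laplace, hitLaw, lintegral_finsetSum_measure]
  refine Finset.sum_congr rfl fun k _ => ?_
  rw [lintegral_smul_measure, lintegral_dirac' _ (by fun_prop), ENNReal.ofReal_mul (hnn k),
    ← Real.exp_nat_mul, smul_eq_mul]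
  congr 3
  ring

instance hitLaw_isFiniteMeasure (N M : ℕ) : IsFiniteMeasure (hitLaw N M) := by
  unfold hitLaw
  refine ⟨?_⟩
  simp [Measure.finsetSum_apply]

theorem hitLaw_univ {N : ℕ} (hN : 2 ≤ N) (M : ℕ) :
    hitLaw N M univ = ENNReal.ofReal (1 - surv N M 1) := by
  have := laplace_hitLaw hN M 0
  simpa [laplace, hitGen_one hN] using this

/-! ### Spectral representation of the survival probabilities -/

/-- The angles `π (2k + 1) / N`. -/
noncomputable def angle (N k : ℕ) : ℝ := Real.pi * (2 * k + 1) / N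

theorem angle_pos {N : ℕ} (hN : 0 < N) (k : ℕ) : 0 < angle N k := by
  unfold angle; positivity

theorem angle_lt {N k : ℕ} (hk : k < N) : angle N k < 2 * Real.pi := by
  have hN : (0 : ℝ) < N := by exact_mod_cast (Nat.zero_le k).trans_lt hk
  have : (k : ℝ) + 1 ≤ N := by exact_mod_cast hk
  rw [angle, div_lt_iff₀ hN]
  nlinarith [Real.pi_pos]

/-- Multiplication by 2 sin(πx / N) makes the sum telescope over a whole number of periods. -/
theorem sum_cos_angle {N : ℕ} (x : ℕ) (hx0 : 0 < x) (hxN : x < N) :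
    ∑ k ∈ Finset.range N, Real.cos (angle N k * x) = 0 := by
  have hN : (0 : ℝ) < N := by exact_mod_cast hx0.trans hxN
  have hx : (0 : ℝ) < x := by exact_mod_cast hx0
  have hx' : (x : ℝ) < N := by exact_mod_cast hxN
  have hs : 0 < Real.sin (Real.pi * x / N) := by
    refine Real.sin_pos_of_pos_of_lt_pi (by positivity) ?_
    rw [div_lt_iff₀ hN]
    nlinarith [Real.pi_pos]
  have h : ∀ k ∈ Finset.range N, 2 * Real.sin (Real.pi * x / N) * Real.cos (angle N k * x) =
      Real.sin (2 * Real.pi * ((k + 1 : ℕ) : ℝ) * x / N) -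
        Real.sin (2 * Real.pi * (k : ℝ) * x / N) := by
    intro k _
    rw [Real.sin_sub_sin]
    have e1 : (2 * Real.pi * ((k + 1 : ℕ) : ℝ) * x / N - 2 * Real.pi * (k : ℝ) * x / N) / 2 =
        Real.pi * x / N := by push_cast; field_simp; ring
    have e2 : (2 * Real.pi * ((k + 1 : ℕ) : ℝ) * x / N + 2 * Real.pi * (k : ℝ) * x / N) / 2 =
        angle N k * x := by unfold angle; push_cast; field_simp; ring
    rw [e1, e2]
  have hsum := Finset.sum_congr rfl h
  rw [← Finset.mul_sum, Finset.sum_range_sub (fun k : ℕ =>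
    Real.sin (2 * Real.pi * (k : ℝ) * x / N))] at hsum
  have e3 : 2 * Real.pi * (N : ℝ) * x / N = x * (2 * Real.pi) := by field_simp
  have e4 : Real.sin (x * (2 * Real.pi)) = 0 := by
    have := Real.sin_nat_mul_pi (x * 2)
    rwa [Nat.cast_mul, Nat.cast_ofNat, mul_assoc] at this
  rw [e3, e4] at hsum
  simp only [CharP.cast_eq_zero, mul_zero, zero_mul, zero_div, Real.sin_zero, sub_zero] at hsum
  rcases mul_eq_zero.1 hsum with h0 | h0
  · linarith
  · exact h0

theorem sin_half_angle_ne_zero {N k : ℕ} (hk : k < N) : Real.sin (angle N k / 2) ≠ 0 := by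
  have hN : 0 < N := (Nat.zero_le k).trans_lt hk
  refine (Real.sin_pos_of_pos_of_lt_pi ?_ ?_).ne'
  · linarith [angle_pos hN k]
  · linarith [angle_lt hk]

/-- This expands the initial condition 1 on the interior in the Dirichlet eigenfunctions. Passing
from x to x + 1 adds two cosine sums; both vanish except that the one at x = 0 equals N. -/
theorem sum_sin_mul_cot {N : ℕ} (x : ℕ) (hx0 : 0 < x) (hxN : x < N) :
    ∑ k ∈ Finset.range N, Real.sin (angle N k * x) *
      (Real.cos (angle N k / 2) / Real.sin (angle N k / 2)) = N := by
  have hstep : ∀ x : ℕ, ∑ k ∈ Finset.range N, Real.sin (angle N k * (x + 1 : ℕ)) *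
      (Real.cos (angle N k / 2) / Real.sin (angle N k / 2)) =
      ∑ k ∈ Finset.range N, Real.sin (angle N k * x) *
      (Real.cos (angle N k / 2) / Real.sin (angle N k / 2)) +
      (∑ k ∈ Finset.range N, Real.cos (angle N k * (x + 1 : ℕ)) +
        ∑ k ∈ Finset.range N, Real.cos (angle N k * x)) := by
    intro x
    rw [← Finset.sum_add_distrib, ← Finset.sum_add_distrib]
    refine Finset.sum_congr rfl fun k hk => ?_
    have hs := sin_half_angle_ne_zero (Finset.mem_range.1 hk)
    set t := angle N k with ht
    have e1 : Real.sin (t * (x + 1 : ℕ)) - Real.sin (t * x) =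
        2 * Real.sin (t / 2) * Real.cos (t * x + t / 2) := by
      rw [Real.sin_sub_sin]; congr 2 <;> (congr 1; push_cast; ring)
    have e2 : Real.cos (t * (x + 1 : ℕ)) + Real.cos (t * x) =
        2 * Real.cos (t * x + t / 2) * Real.cos (t / 2) := by
      rw [Real.cos_add_cos]; congr 2 <;> (congr 1; push_cast; ring)
    rw [e2, ← sub_eq_iff_eq_add', ← sub_mul, e1]
    field_simp
  induction x, hx0 using Nat.le_induction with
  | base =>
    have h := hstep 0
    rw [zero_add] at h
    rw [h, sum_cos_angle 1 one_pos hxN]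
    simp
  | succ x hx ih =>
    rw [hstep x, ih (by omega), sum_cos_angle (x + 1) (by omega) hxN,
      sum_cos_angle x (by omega) (by omega)]
    simp

theorem sin_angle_mul_boundary {N k : ℕ} (hk : k < N) {x : ℤ} (hx : x = 0 ∨ x = N) :
    Real.sin (angle N k * x) = 0 := by
  have hN : (N : ℝ) ≠ 0 := by
    have : N ≠ 0 := by omega
    exact_mod_cast this
  rcases hx with h | h
  · simp [h]
  · rw [h, angle, Int.cast_natCast, div_mul_cancel₀ _ hN, mul_comm]
    exact_mod_cast Real.sin_nat_mul_pi (2 * k + 1)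

/-- Each x ↦ sin(θx), with θ one of the angles, vanishes at 0 and N and is an eigenfunction of the
averaging operator with eigenvalue cos θ. -/
theorem mul_surv {N : ℕ} (n : ℕ) (x : ℤ) (hx0 : 0 ≤ x) (hxN : x ≤ N) :
    N * surv N n x = ∑ k ∈ Finset.range N, Real.cos (angle N k) ^ n *
      (Real.sin (angle N k * x) * (Real.cos (angle N k / 2) / Real.sin (angle N k / 2))) := by
  induction n generalizing x with
  | zero =>
    by_cases hx : 0 < x ∧ x < N
    · lift x to ℕ using hx0
      rw [surv_zero hx]
      simp only [pow_zero, one_mul, mul_one, Int.cast_natCast]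
      exact (sum_sin_mul_cot x (by omega) (by omega)).symm
    · rw [surv_of_not_mem hx, mul_zero, Finset.sum_eq_zero]
      intro k hk
      rw [sin_angle_mul_boundary (Finset.mem_range.1 hk) (by omega)]
      simp
  | succ n ih =>
    by_cases hx : 0 < x ∧ x < N
    · have h1 := ih (x + 1) (by omega) (by omega)
      have h2 := ih (x - 1) (by omega) (by omega)
      rw [surv_succ hx, mul_div_assoc', mul_add, h1, h2, ← Finset.sum_add_distrib,
        Finset.sum_div]
      refine Finset.sum_congr rfl fun k _ => ?_
      have e : Real.sin (angle N k * ((x + 1 : ℤ) : ℝ)) + Real.sin (angle N k * ((x - 1 : ℤ) : ℝ)) =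
          2 * Real.sin (angle N k * x) * Real.cos (angle N k) := by
        have a1 : (angle N k * ((x + 1 : ℤ) : ℝ) + angle N k * ((x - 1 : ℤ) : ℝ)) / 2 =
            angle N k * x := by push_cast; ring
        have a2 : (angle N k * ((x + 1 : ℤ) : ℝ) - angle N k * ((x - 1 : ℤ) : ℝ)) / 2 =
            angle N k := by push_cast; ring
        rw [Real.sin_add_sin, a1, a2]
      rw [← mul_add, ← add_mul, e, pow_succ]
      ring
    · rw [surv_of_not_mem hx, mul_zero, Finset.sum_eq_zero]
      intro k hk
      rw [sin_angle_mul_boundary (Finset.mem_range.1 hk) (by omega)]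
      simp

theorem mul_surv_one {N : ℕ} (hN : 0 < N) (n : ℕ) :
    N * surv N n 1 = ∑ k ∈ Finset.range N,
      Real.cos (angle N k) ^ n * (1 + Real.cos (angle N k)) := by
  rw [mul_surv n 1 (by norm_num) (by omega)]
  refine Finset.sum_congr rfl fun k hk => ?_
  have hs := sin_half_angle_ne_zero (Finset.mem_range.1 hk)
  congr 1
  have e1 : Real.sin (angle N k) = 2 * Real.sin (angle N k / 2) * Real.cos (angle N k / 2) := by
    rw [← Real.sin_two_mul]; congr 1; ring
  have e2 : Real.cos (angle N k) = 2 * Real.cos (angle N k / 2) ^ 2 - 1 := by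
    rw [← Real.cos_two_mul]; congr 1; ring
  rw [Int.cast_one, mul_one, e1, e2]
  field_simp
  ring

/-- Bernoulli's inequality gives (1 + nt)(1 - t)^n ≤ (1 - t²)^n ≤ 1. It is applied with t = 1 + cos
θ, where cos θ ≤ 0. -/
theorem pow_mul_one_sub_le {t : ℝ} (h0 : 0 ≤ t) (h1 : t ≤ 1) (n : ℕ) :
    (1 - t) ^ n * t ≤ 1 / (n + 1) := by
  have hb : (1 + n * t) * (1 - t) ^ n ≤ 1 := by
    have h2 : 1 + (n : ℝ) * t ≤ (1 + t) ^ n := one_add_mul_le_pow (by linarith) n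
    calc (1 + n * t) * (1 - t) ^ n ≤ (1 + t) ^ n * (1 - t) ^ n := by
          gcongr
      _ = (1 - t ^ 2) ^ n := by rw [← mul_pow]; ring
      _ ≤ 1 := pow_le_one₀ (by nlinarith) (by nlinarith)
  rw [le_div_iff₀ (by positivity)]
  have h3 : 0 ≤ (1 - t) ^ n := pow_nonneg (by linarith) n
  nlinarith

/-- The contribution of the angles up to `π / 2`. -/
noncomputable def lowTerm (N n k : ℕ) : ℝ :=
  if 2 * (2 * k + 1) ≤ N then Real.cos (angle N k) ^ n * (1 + Real.cos (angle N k)) else 0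

/-- The angles θ and 2π - θ have the same cosine, hence the factor 2. Where cos θ ≤ 0 the power need
not be small, but the factor 1 + cos θ keeps each term below 1/(n + 1). -/
theorem abs_mul_surv_sub_le {N : ℕ} (hN : 0 < N) (n : ℕ) :
    |N * surv N n 1 - 2 * ∑ k ∈ Finset.range N, lowTerm N n k| ≤ N / (n + 1) := by
  have hN' : (0 : ℝ) < N := by exact_mod_cast hN
  rw [mul_surv_one hN, two_mul]
  nth_rw 1 [← Finset.sum_range_reflect (fun k => lowTerm N n k)]
  rw [← Finset.sum_add_distrib, ← Finset.sum_sub_distrib]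
  refine (Finset.abs_sum_le_sum_abs _ _).trans ?_
  have hb : ∀ k ∈ Finset.range N, |Real.cos (angle N k) ^ n * (1 + Real.cos (angle N k)) -
      (lowTerm N n (N - 1 - k) + lowTerm N n k)| ≤ 1 / (n + 1) := by
    intro k hk
    have hkN : k < N := Finset.mem_range.1 hk
    have hcast : ((N - 1 - k : ℕ) : ℝ) = N - 1 - k := by
      rw [Nat.sub_sub, Nat.cast_sub (by omega)]; push_cast; ring
    have hrefl : angle N (N - 1 - k) = 2 * Real.pi - angle N k := by
      unfold angle; rw [hcast]; field_simp; ring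
    have hcos : Real.cos (angle N (N - 1 - k)) = Real.cos (angle N k) := by
      rw [hrefl, Real.cos_two_pi_sub]
    have hpos : (0 : ℝ) ≤ 1 / (n + 1) := by positivity
    unfold lowTerm
    rw [hcos]
    by_cases h1 : 2 * (2 * k + 1) ≤ N
    · rw [if_pos h1, if_neg (by omega)]; simpa using hpos
    · by_cases h2 : 2 * (2 * (N - 1 - k) + 1) ≤ N
      · rw [if_neg h1, if_pos h2]; simpa using hpos
      · rw [if_neg h1, if_neg h2]
        have h1' : (N : ℝ) ≤ 2 * (2 * k + 1) := by exact_mod_cast (not_le.1 h1).le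
        have h2' : (N : ℝ) ≤ 2 * (2 * (N - 1 - k) + 1) := by
          rw [← hcast]; exact_mod_cast (not_le.1 h2).le
        have hc : Real.cos (angle N k) ≤ 0 := by
          refine Real.cos_nonpos_of_pi_div_two_le_of_le ?_ ?_
          · rw [angle, le_div_iff₀ hN']; nlinarith [Real.pi_pos]
          · rw [angle, div_le_iff₀ hN']; nlinarith [Real.pi_pos]
        have hc1 := Real.neg_one_le_cos (angle N k)
        have := pow_mul_one_sub_le (t := 1 + Real.cos (angle N k)) (by linarith) (by linarith) n
        rw [add_zero, sub_zero, abs_mul, abs_pow, abs_of_nonpos hc,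
          abs_of_nonneg (by linarith : 0 ≤ 1 + Real.cos (angle N k))]
        convert this using 3
        ring
  refine (Finset.sum_le_sum hb).trans ?_
  rw [Finset.sum_const, Finset.card_range, nsmul_eq_mul]
  exact le_of_eq (by ring)

/-! ### Uniform bounds and the diffusive limit of the survival probability. -/

theorem summable_H {y : ℝ} (hy : 0 < y) :
    Summable fun k : ℕ => Real.exp (-(Real.pi ^ 2 * (2 * (k : ℝ) + 1) ^ 2 * y / 2)) := by
  have hpi := Real.pi_pos
  refine Summable.of_nonneg_of_le (fun k => by positivity) (fun k => ?_)
    (summable_geometric_of_lt_one (r := Real.exp (-(Real.pi ^ 2 * y / 2))) (by positivity) ?_)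
  · rw [← Real.exp_nat_mul]
    refine Real.exp_le_exp.2 ?_
    have hk : (0 : ℝ) ≤ k := by positivity
    have : (0 : ℝ) ≤ Real.pi ^ 2 * y / 2 := by positivity
    nlinarith [mul_nonneg this hk, mul_nonneg (mul_nonneg this hk) hk]
  · rw [Real.exp_lt_one_iff]; simp; positivity

theorem H_pos {y : ℝ} (hy : 0 < y) : 0 < H y :=
  (summable_H hy).tsum_pos (fun k => by positivity) 0 (by positivity)

theorem H_anti {x y : ℝ} (hx : 0 < x) (hxy : x ≤ y) : H y ≤ H x := by
  refine Summable.tsum_le_tsum (fun k => ?_) (summable_H (hx.trans_le hxy)) (summable_H hx)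
  gcongr

theorem lowTerm_nonneg (N n k : ℕ) : 0 ≤ lowTerm N n k := by
  unfold lowTerm
  split_ifs with h
  · have hN : (0 : ℝ) < N := by exact_mod_cast (by omega : 0 < N)
    have hc : 0 ≤ Real.cos (angle N k) := by
      refine Real.cos_nonneg_of_neg_pi_div_two_le_of_le ?_ ?_
      · have := angle_pos (by omega : 0 < N) k
        linarith [Real.pi_pos]
      · rw [angle, div_le_iff₀ hN]
        have : 2 * (2 * (k : ℝ) + 1) ≤ N := by exact_mod_cast h
        nlinarith [Real.pi_pos]
    positivity
  · rfl

/-- Uses cos θ ≤ 1 - 2θ²/π² ≤ e^{-2θ²/π²}. The exponent is off from the true one by the factor 4/π²,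
which is harmless because only a dominating bound is needed. -/
theorem lowTerm_le (N n k : ℕ) :
    lowTerm N n k ≤ 2 * Real.exp (-(Real.pi ^ 2 * (2 * (k : ℝ) + 1) ^ 2 *
      (4 / Real.pi ^ 2 * (n / N ^ 2)) / 2)) := by
  unfold lowTerm
  split_ifs with h
  · have hN : (0 : ℝ) < N := by exact_mod_cast (by omega : 0 < N)
    have hang := angle_pos (by omega : 0 < N) k
    have hle : angle N k ≤ Real.pi / 2 := by
      rw [angle, div_le_iff₀ hN]
      have : 2 * (2 * (k : ℝ) + 1) ≤ N := by exact_mod_cast h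
      nlinarith [Real.pi_pos]
    have hc : 0 ≤ Real.cos (angle N k) :=
      Real.cos_nonneg_of_neg_pi_div_two_le_of_le (by linarith [Real.pi_pos]) hle
    have hcos : Real.cos (angle N k) ≤ Real.exp (-(2 / Real.pi ^ 2 * angle N k ^ 2)) := by
      have h1 := Real.cos_le_one_sub_mul_cos_sq (x := angle N k)
        (by rw [abs_of_pos hang]; linarith [Real.pi_pos])
      exact h1.trans (Real.one_sub_le_exp_neg _)
    have hpow : Real.cos (angle N k) ^ n ≤
        Real.exp (-(Real.pi ^ 2 * (2 * (k : ℝ) + 1) ^ 2 * (4 / Real.pi ^ 2 * (n / N ^ 2)) / 2)) := by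
      refine (pow_le_pow_left₀ hc hcos n).trans (le_of_eq ?_)
      rw [← Real.exp_nat_mul]
      congr 1
      unfold angle
      have := Real.pi_pos.ne'
      field_simp
      ring
    nlinarith [Real.cos_le_one (angle N k), Real.exp_pos (-(Real.pi ^ 2 * (2 * (k : ℝ) + 1) ^ 2 *
      (4 / Real.pi ^ 2 * (n / N ^ 2)) / 2)), pow_nonneg hc n]
  · positivity

theorem lowTerm_of_le {N n k : ℕ} (h : N ≤ k) : lowTerm N n k = 0 := by
  unfold lowTerm; rw [if_neg (by omega)]

theorem tsum_lowTerm (N n : ℕ) : ∑' k, lowTerm N n k = ∑ k ∈ Finset.range N, lowTerm N n k :=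
  tsum_eq_sum fun k hk => lowTerm_of_le (by simpa using hk)

/-- A bound for the survival probability, uniform in `N`. -/
theorem mul_surv_one_le {N n : ℕ} (hN : 0 < N) (hn : 0 < n) :
    N * surv N n 1 ≤ 4 * H (4 / Real.pi ^ 2 * (n / N ^ 2)) + N / (n + 1) := by
  have hpi := Real.pi_pos
  have hy : 0 < 4 / Real.pi ^ 2 * ((n : ℝ) / N ^ 2) := by positivity
  have h1 := (abs_le.1 (abs_mul_surv_sub_le hN n)).2
  have h2 : ∑ k ∈ Finset.range N, lowTerm N n k ≤ 2 * H (4 / Real.pi ^ 2 * (n / N ^ 2)) := by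
    rw [← tsum_lowTerm, H, ← tsum_mul_left]
    have hs := (summable_H hy).mul_left 2
    exact Summable.tsum_le_tsum (fun k => lowTerm_le N n k)
      (Summable.of_nonneg_of_le (lowTerm_nonneg N n) (lowTerm_le N n) hs) hs
  linarith

/-- Here n log cos(c/N) is rewritten with cos u - 1 = -2 sin²(u/2); `Real.sinc` and `dslope Real.log
1` are continuous substitutes for the quotients, so no division by zero arises. -/
theorem tendsto_cos_pow {N n : ℕ → ℕ} {y : ℝ} (c : ℝ) (hN : Tendsto N atTop atTop)
    (hy : Tendsto (fun M => (n M : ℝ) / (N M : ℝ) ^ 2) atTop (𝓝 y)) :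
    Tendsto (fun M => Real.cos (c / N M) ^ n M) atTop (𝓝 (Real.exp (-(c ^ 2 * y / 2)))) := by
  have hN' : Tendsto (fun M => (N M : ℝ)) atTop atTop := tendsto_natCast_atTop_atTop.comp hN
  have hcN : Tendsto (fun M => c / (N M : ℝ)) atTop (𝓝 0) := hN'.const_div_atTop c
  have hcN2 : Tendsto (fun M => c / (2 * (N M : ℝ))) atTop (𝓝 0) :=
    (hN'.const_mul_atTop two_pos).const_div_atTop c
  have hcos : Tendsto (fun M => Real.cos (c / N M)) atTop (𝓝 1) := by
    have := (Real.continuous_cos.tendsto 0).comp hcN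
    rwa [Real.cos_zero] at this
  have hsinc : Tendsto (fun M => Real.sinc (c / (2 * (N M : ℝ)))) atTop (𝓝 1) := by
    have := (Real.continuous_sinc.tendsto 0).comp hcN2
    rwa [Real.sinc_zero] at this
  have hds : Tendsto (fun M => dslope Real.log 1 (Real.cos (c / N M))) atTop (𝓝 1) := by
    have h : ContinuousAt (dslope Real.log 1) 1 :=
      continuousAt_dslope_same.2 (Real.differentiableAt_log one_ne_zero)
    have := h.tendsto.comp hcos
    rwa [dslope_same, Real.deriv_log, inv_one] at this
  have hmain : Tendsto (fun M => -(1 / 2) * c ^ 2 * ((n M : ℝ) / (N M : ℝ) ^ 2) *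
      Real.sinc (c / (2 * (N M : ℝ))) ^ 2 * dslope Real.log 1 (Real.cos (c / N M))) atTop
      (𝓝 (-(1 / 2) * c ^ 2 * y * 1 ^ 2 * 1)) :=
    ((hy.const_mul _).mul (hsinc.pow 2)).mul hds
  have hexp := (Real.continuous_exp.tendsto _).comp hmain
  have he : -(1 / 2) * c ^ 2 * y * 1 ^ 2 * 1 = -(c ^ 2 * y / 2) := by ring
  rw [he] at hexp
  refine hexp.congr' ?_
  filter_upwards [hcos.eventually_const_lt (show (1 / 2 : ℝ) < 1 by norm_num),
    hN'.eventually_gt_atTop 0] with M hM hNM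
  have hpos : 0 < Real.cos (c / N M) := by linarith
  have hlog : Real.log (Real.cos (c / N M)) =
      (Real.cos (c / N M) - 1) * dslope Real.log 1 (Real.cos (c / N M)) := by
    have := sub_smul_dslope Real.log 1 (Real.cos (c / N M))
    rw [Real.log_one, sub_zero, smul_eq_mul] at this
    exact this.symm
  have hsin : Real.sin (c / (2 * N M)) = c / (2 * N M) * Real.sinc (c / (2 * N M)) := by
    by_cases h0 : c / (2 * (N M : ℝ)) = 0
    · simp [h0]
    · rw [Real.sinc_of_ne_zero h0, mul_div_cancel₀ _ h0]
  have hcos1 : Real.cos (c / N M) - 1 = -2 * Real.sin (c / (2 * N M)) ^ 2 := by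
    have h1 := Real.cos_two_mul (c / (2 * N M))
    have h2 : 2 * (c / (2 * (N M : ℝ))) = c / N M := by field_simp
    rw [h2] at h1
    nlinarith [Real.sin_sq_add_cos_sq (c / (2 * N M))]
  simp only [Function.comp]
  rw [← Real.exp_log (pow_pos hpos (n M)), Real.log_pow, hlog, hcos1, hsin]
  congr 1
  field_simp

/-- The survival probability in the diffusive regime. -/
theorem tendsto_mul_surv_one {N n : ℕ → ℕ} {y : ℝ} (hy : 0 < y) (hN : Tendsto N atTop atTop)
    (hn : Tendsto (fun M => (n M : ℝ) / (N M : ℝ) ^ 2) atTop (𝓝 y)) :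
    Tendsto (fun M => N M * surv (N M) (n M) 1) atTop (𝓝 (4 * H y)) := by
  have hpi := Real.pi_pos
  have hN' : Tendsto (fun M => (N M : ℝ)) atTop atTop := tendsto_natCast_atTop_atTop.comp hN
  have hterm : ∀ k : ℕ, Tendsto (fun M => lowTerm (N M) (n M) k) atTop
      (𝓝 (2 * Real.exp (-(Real.pi ^ 2 * (2 * (k : ℝ) + 1) ^ 2 * y / 2)))) := by
    intro k
    have h1 := tendsto_cos_pow (Real.pi * (2 * k + 1)) hN hn
    have h2 : Tendsto (fun M => 1 + Real.cos (Real.pi * (2 * k + 1) / N M)) atTop (𝓝 2) := by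
      have := (Real.continuous_cos.tendsto 0).comp
        (hN'.const_div_atTop (Real.pi * (2 * k + 1)))
      rw [Real.cos_zero] at this
      have := this.const_add 1
      rwa [show (1 : ℝ) + 1 = 2 by norm_num] at this
    have h3 := h1.mul h2
    rw [mul_pow, mul_comm (Real.exp _)] at h3
    refine h3.congr' ?_
    filter_upwards [hN.eventually_ge_atTop (2 * (2 * k + 1))] with M hM
    rw [lowTerm, if_pos hM]
    rfl
  have hy2 : 0 < 4 / Real.pi ^ 2 * (y / 2) := by positivity
  have hbd : ∀ᶠ M in atTop, ∀ k, ‖lowTerm (N M) (n M) k‖ ≤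
      2 * Real.exp (-(Real.pi ^ 2 * (2 * (k : ℝ) + 1) ^ 2 * (4 / Real.pi ^ 2 * (y / 2)) / 2)) := by
    filter_upwards [hn.eventually_const_le (show y / 2 < y by linarith)] with M hM k
    rw [Real.norm_of_nonneg (lowTerm_nonneg _ _ _)]
    refine (lowTerm_le _ _ _).trans ?_
    gcongr
  have hlim := tendsto_tsum_of_dominated_convergence ((summable_H hy2).mul_left 2) hterm hbd
  rw [tsum_mul_left] at hlim
  have herr : Tendsto (fun M => (N M : ℝ) / (n M + 1)) atTop (𝓝 0) := by
    have h1 : Tendsto (fun M => (((n M : ℝ) / (N M : ℝ) ^ 2)⁻¹) * (1 / (N M : ℝ))) atTop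
        (𝓝 (y⁻¹ * 0)) := (hn.inv₀ hy.ne').mul (hN'.const_div_atTop 1)
    rw [mul_zero] at h1
    refine tendsto_of_tendsto_of_tendsto_of_le_of_le' tendsto_const_nhds h1
      (Eventually.of_forall fun M => by positivity) ?_
    filter_upwards [hn.eventually_const_lt hy, hN'.eventually_gt_atTop 0] with M hM hNM
    have hnM : (0 : ℝ) < n M := by
      by_contra h
      have : (n M : ℝ) = 0 := le_antisymm (not_lt.1 h) (by positivity)
      simp [this] at hM
    have : ((n M : ℝ) / (N M : ℝ) ^ 2)⁻¹ * (1 / (N M : ℝ)) = N M / n M := by field_simp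
    rw [this]
    gcongr
    linarith
  have hdiff : Tendsto (fun M => N M * surv (N M) (n M) 1 - 2 * ∑' k, lowTerm (N M) (n M) k)
      atTop (𝓝 0) := by
    refine squeeze_zero_norm' ?_ herr
    filter_upwards [hN.eventually_gt_atTop 0] with M hM
    rw [tsum_lowTerm]
    exact abs_mul_surv_sub_le hM (n M)
  -- The constant 4 is the 2 from pairing the angles times the limit 2 of 1 + cos θ.
  have := hdiff.add (hlim.const_mul 2)
  rw [zero_add, ← mul_assoc] at this
  norm_num at this
  exact this

/-! ### Analysis of `H` and `μ` -/

/-- The one-sided Gaussian sum `∑_{k ≥ 0} exp(-π² k² y / 2)`. -/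
noncomputable def gaussSum (y : ℝ) : ℝ := ∑' k : ℕ, Real.exp (-(Real.pi ^ 2 * (k : ℝ) ^ 2 * y / 2))

theorem summable_gaussSum {y : ℝ} (hy : 0 < y) :
    Summable fun k : ℕ => Real.exp (-(Real.pi ^ 2 * (k : ℝ) ^ 2 * y / 2)) := by
  have hpi := Real.pi_pos
  refine Summable.of_nonneg_of_le (fun k => by positivity) (fun k => ?_)
    (summable_geometric_of_lt_one (r := Real.exp (-(Real.pi ^ 2 * y / 2))) (by positivity) ?_)
  · rw [← Real.exp_nat_mul]
    refine Real.exp_le_exp.2 ?_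
    have hk : (k : ℝ) ≤ (k : ℝ) ^ 2 := by exact_mod_cast Nat.le_self_pow two_ne_zero k
    have : (0 : ℝ) ≤ Real.pi ^ 2 * y / 2 := by positivity
    nlinarith [mul_le_mul_of_nonneg_left hk this]
  · rw [Real.exp_lt_one_iff]; simp; positivity

/-- Even indices rescale y by 4 and odd indices give H, so the behaviour of H near 0 follows from
the theta function. -/
theorem gaussSum_eq {y : ℝ} (hy : 0 < y) : gaussSum y = gaussSum (4 * y) + H y := by
  have h := summable_gaussSum hy
  have he : (fun k : ℕ => Real.exp (-(Real.pi ^ 2 * ((2 * k : ℕ) : ℝ) ^ 2 * y / 2))) =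
      fun k : ℕ => Real.exp (-(Real.pi ^ 2 * (k : ℝ) ^ 2 * (4 * y) / 2)) := by
    ext k; congr 1; push_cast; ring
  have ho : (fun k : ℕ => Real.exp (-(Real.pi ^ 2 * ((2 * k + 1 : ℕ) : ℝ) ^ 2 * y / 2))) =
      fun k : ℕ => Real.exp (-(Real.pi ^ 2 * (2 * (k : ℝ) + 1) ^ 2 * y / 2)) := by
    ext k; congr 1; push_cast; ring
  have := tsum_even_add_odd
    (f := fun k : ℕ => Real.exp (-(Real.pi ^ 2 * (k : ℝ) ^ 2 * y / 2)))
    (by rw [he]; exact summable_gaussSum (by linarith)) (by rw [ho]; exact summable_H hy)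
  rw [he, ho] at this
  exact this.symm

theorem tsum_int_gauss {y : ℝ} (hy : 0 < y) :
    ∑' n : ℤ, Real.exp (-(Real.pi ^ 2 * (n : ℝ) ^ 2 * y / 2)) = 2 * gaussSum y - 1 := by
  have h := (summable_gaussSum hy).hasSum
  have h2 := HasSum.of_nat_of_neg (f := fun n : ℤ =>
    Real.exp (-(Real.pi ^ 2 * (n : ℝ) ^ 2 * y / 2))) (by simpa using h) (by simpa using h)
  rw [h2.tsum_eq, gaussSum]
  simp
  ring

/-- Jacobi's theta identity with parameter πy/2; it exchanges y → 0 with y → ∞. -/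
theorem gaussSum_functional {y : ℝ} (hy : 0 < y) :
    √y * (2 * gaussSum y - 1) = √(2 / Real.pi) * (2 * gaussSum (4 / Real.pi ^ 2 * y⁻¹) - 1) := by
  have hpi := Real.pi_pos
  have h := Real.tsum_exp_neg_mul_int_sq (a := Real.pi * y / 2) (by positivity)
  rw [← tsum_int_gauss hy, ← tsum_int_gauss (by positivity)]
  have e1 : ∀ n : ℤ, -(Real.pi ^ 2 * (n : ℝ) ^ 2 * y / 2) =
      -Real.pi * (Real.pi * y / 2) * (n : ℝ) ^ 2 := fun n => by ring
  have e2 : ∀ n : ℤ, -(Real.pi ^ 2 * (n : ℝ) ^ 2 * (4 / Real.pi ^ 2 * y⁻¹) / 2) =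
      -Real.pi / (Real.pi * y / 2) * (n : ℝ) ^ 2 := fun n => by field_simp; ring
  simp_rw [e1, e2]
  rw [h, ← mul_assoc, ← Real.sqrt_eq_rpow]
  congr 1
  rw [mul_one_div, ← Real.sqrt_div' _ (by positivity)]
  congr 1
  field_simp

theorem tendsto_gaussSum_atTop : Tendsto gaussSum atTop (𝓝 1) := by
  have hpi := Real.pi_pos
  have h := tendsto_tsum_of_dominated_convergence (𝓕 := (atTop : Filter ℝ))
    (f := fun y (k : ℕ) => Real.exp (-(Real.pi ^ 2 * (k : ℝ) ^ 2 * y / 2)))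
    (g := fun k : ℕ => if k = 0 then (1 : ℝ) else 0)
    (summable_gaussSum one_pos) ?_ ?_
  · rwa [tsum_ite_eq] at h
  · intro k
    by_cases hk : k = 0
    · simp [hk]
    · simp only [hk, if_false]
      have hk' : (0 : ℝ) < k := by positivity
      refine Real.tendsto_exp_neg_atTop_nhds_zero.comp ?_
      have := (tendsto_id (α := ℝ) (x := atTop)).const_mul_atTop
        (show 0 < Real.pi ^ 2 * (k : ℝ) ^ 2 / 2 by positivity)
      refine this.congr fun y => ?_
      simp only [id]; ring
  · filter_upwards [eventually_ge_atTop 1] with y hy k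
    rw [Real.norm_of_nonneg (by positivity)]
    gcongr

/-- `H(y)` blows up at `0` like a constant multiple of `1 / √y`. -/
theorem tendsto_sqrt_mul_H : ∃ c : ℝ, 0 < c ∧ Tendsto (fun y => √y * H y) (𝓝[>] 0) (𝓝 c) := by
  have hpi := Real.pi_pos
  have hg : Tendsto (fun y => √y * gaussSum y) (𝓝[>] 0) (𝓝 (√(2 / Real.pi) / 2)) := by
    have h1 : Tendsto (fun y : ℝ => 4 / Real.pi ^ 2 * y⁻¹) (𝓝[>] 0) atTop :=
      tendsto_inv_nhdsGT_zero.const_mul_atTop (by positivity)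
    have h2 := tendsto_gaussSum_atTop.comp h1
    have h3 : Tendsto (fun y : ℝ => √y) (𝓝[>] 0) (𝓝 0) := by
      have := (Real.continuous_sqrt.tendsto 0).mono_left (nhdsWithin_le_nhds (s := Ioi 0))
      rwa [Real.sqrt_zero] at this
    have h4 := (((h2.const_mul 2).sub_const 1).const_mul √(2 / Real.pi)).add h3
    have h5 := h4.div_const 2
    have e : (√(2 / Real.pi) * (2 * 1 - 1) + 0) / 2 = √(2 / Real.pi) / 2 := by ring
    rw [e] at h5
    refine h5.congr' ?_
    filter_upwards [self_mem_nhdsWithin] with y hy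
    have := gaussSum_functional hy
    simp only [Function.comp]
    linarith
  -- With c₀ = √(2/π)/2 the limit of √y `gaussSum y`, the term √y `gaussSum (4 * y)` tends to c₀/2,
  -- and the difference is c₀/2.
  refine ⟨√(2 / Real.pi) / 4, by positivity, ?_⟩
  have h4 : Tendsto (fun y : ℝ => 4 * y) (𝓝[>] 0) (𝓝[>] 0) := by
    refine tendsto_nhdsWithin_iff.2 ⟨?_, ?_⟩
    · have : Tendsto (fun y : ℝ => 4 * y) (𝓝 0) (𝓝 (4 * 0)) := tendsto_id.const_mul 4
      rw [mul_zero] at this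
      exact this.mono_left nhdsWithin_le_nhds
    · filter_upwards [self_mem_nhdsWithin] with y hy
      have : (0 : ℝ) < y := hy
      exact mem_Ioi.2 (by linarith)
  have h5 := hg.sub ((hg.comp h4).div_const 2)
  have e : √(2 / Real.pi) / 2 - √(2 / Real.pi) / 2 / 2 = √(2 / Real.pi) / 4 := by ring
  rw [e] at h5
  refine h5.congr' ?_
  filter_upwards [self_mem_nhdsWithin] with y hy
  have hs : √(4 * y) = 2 * √y := by
    rw [Real.sqrt_mul (by norm_num), show (4 : ℝ) = 2 ^ 2 by norm_num, Real.sqrt_sq two_pos.le]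
  simp only [Function.comp]
  rw [hs, gaussSum_eq hy]
  ring

/-- As (2k + 1)² - 1 = 4k(k + 1), only the k = 0 term survives. -/
theorem tendsto_exp_mul_H :
    Tendsto (fun y => Real.exp (Real.pi ^ 2 * y / 2) * H y) atTop (𝓝 1) := by
  have hpi := Real.pi_pos
  have e : ∀ (k : ℕ) (y : ℝ), Real.exp (Real.pi ^ 2 * y / 2) *
      Real.exp (-(Real.pi ^ 2 * (2 * (k : ℝ) + 1) ^ 2 * y / 2)) =
      Real.exp (-(2 * Real.pi ^ 2 * k * (k + 1) * y)) := by
    intro k y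
    rw [← Real.exp_add]; congr 1; ring
  simp_rw [H, ← tsum_mul_left, e]
  have hs : Summable fun k : ℕ => Real.exp (-(2 * Real.pi ^ 2 * k * (k + 1) * 1)) := by
    have := (summable_H one_pos).mul_left (Real.exp (Real.pi ^ 2 * 1 / 2))
    simpa only [e] using this
  have h := tendsto_tsum_of_dominated_convergence (𝓕 := (atTop : Filter ℝ))
    (f := fun y (k : ℕ) => Real.exp (-(2 * Real.pi ^ 2 * k * (k + 1) * y)))
    (g := fun k : ℕ => if k = 0 then (1 : ℝ) else 0) hs ?_ ?_
  · rwa [tsum_ite_eq] at h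
  · intro k
    by_cases hk : k = 0
    · simp [hk]
    · simp only [hk, if_false]
      have hk' : (0 : ℝ) < k := by positivity
      refine Real.tendsto_exp_neg_atTop_nhds_zero.comp ?_
      exact (tendsto_id (α := ℝ) (x := atTop)).const_mul_atTop
        (show 0 < 2 * Real.pi ^ 2 * k * (k + 1) by positivity)
  · filter_upwards [eventually_ge_atTop 1] with y hy k
    rw [Real.norm_of_nonneg (by positivity)]
    gcongr

theorem hasSum_one_div_odd_sq : HasSum (fun k : ℕ => 1 / (2 * (k : ℝ) + 1) ^ 2)
    (Real.pi ^ 2 / 8) := by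
  set f : ℕ → ℝ := fun n => 1 / (n : ℝ) ^ 2 with hf
  have h : HasSum f (Real.pi ^ 2 / 6) := hasSum_zeta_two
  have he : HasSum (fun k => f (2 * k)) (1 / 4 * (Real.pi ^ 2 / 6)) := by
    have e : (fun k => f (2 * k)) = fun k => 1 / 4 * f k := by
      ext k
      simp only [hf]
      push_cast
      rw [mul_pow, ← one_div_mul_one_div]
      norm_num
    rw [e]
    exact h.mul_left _
  have hos : Summable (fun k => f (2 * k + 1)) :=
    h.summable.comp_injective (i := fun k : ℕ => 2 * k + 1) (fun a b hab => by
      simp only at hab; omega)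
  have h3 := (he.even_add_odd hos.hasSum).unique h
  have h4 : ∑' k, f (2 * k + 1) = Real.pi ^ 2 / 8 := by linarith
  have h5 := hos.hasSum
  rw [h4] at h5
  convert h5 using 1
  ext k
  simp only [hf, Nat.cast_add, Nat.cast_mul, Nat.cast_ofNat, Nat.cast_one]

/-- Termwise integration gives (2/π²) ∑ 1/(2k + 1)² = (2/π²)(π²/8). -/
theorem integral_H_Ioi : ∫ y in Ioi (0 : ℝ), H y = 1 / 4 := by
  have hpi := Real.pi_pos
  set a : ℕ → ℝ := fun k => -(Real.pi ^ 2 * (2 * (k : ℝ) + 1) ^ 2 / 2) with ha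
  have haneg : ∀ k, a k < 0 := fun k => by
    simp only [ha]
    have : 0 < Real.pi ^ 2 * (2 * (k : ℝ) + 1) ^ 2 / 2 := by positivity
    linarith
  have hterm : ∀ (k : ℕ) (y : ℝ),
      -(Real.pi ^ 2 * (2 * (k : ℝ) + 1) ^ 2 * y / 2) = a k * y := fun k y => by
    simp only [ha]; ring
  have hval : ∀ k, ∫ y in Ioi (0 : ℝ), Real.exp (a k * y) =
      2 / Real.pi ^ 2 * (1 / (2 * (k : ℝ) + 1) ^ 2) := fun k => by
    rw [integral_exp_mul_Ioi (haneg k)]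
    simp only [ha, mul_zero, Real.exp_zero]
    field_simp
  have hs := (hasSum_one_div_odd_sq.mul_left (2 / Real.pi ^ 2))
  have h := hasSum_integral_of_summable_integral_norm (μ := volume.restrict (Ioi (0 : ℝ)))
    (F := fun (k : ℕ) y => Real.exp (a k * y))
    (fun k => integrableOn_exp_mul_Ioi (haneg k) 0) (by
      simp_rw [Real.norm_of_nonneg (Real.exp_pos _).le, hval]
      exact hs.summable)
  simp_rw [hval] at h
  have := h.unique hs
  unfold H
  simp_rw [hterm]
  rw [this]
  field_simp
  norm_num

/-- A non-integrable function has integral 0 by convention, which the value 1/4 excludes. -/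
theorem integrableOn_H : IntegrableOn H (Ioi 0) := by
  by_contra h
  have := integral_H_Ioi
  rw [integral_undef h] at this
  norm_num at this

theorem intervalIntegrable_H {ρ : ℝ} (hρ : 0 ≤ ρ) : IntervalIntegrable H volume 0 ρ :=
  (intervalIntegrable_iff_integrableOn_Ioc_of_le hρ).2 (integrableOn_H.mono_set Ioc_subset_Ioi_self)

theorem intervalIntegrable_H_mul {ρ : ℝ} (hρ : 0 < ρ) :
    IntervalIntegrable (fun v => H (v * ρ)) volume 0 1 := by
  have := (intervalIntegrable_H hρ.le).comp_mul_right (c := ρ)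
  simpa [hρ.ne'] using this

theorem integral_H_mul {ρ : ℝ} (hρ : 0 < ρ) :
    ∫ v in (0 : ℝ)..1, H (v * ρ) = ρ⁻¹ * ∫ y in (0 : ℝ)..ρ, H y := by
  rw [intervalIntegral.integral_comp_mul_right _ hρ.ne']
  simp

theorem tendsto_mu_atTop :
    mu ~[atTop] (fun ρ : ℝ => Real.exp (Real.pi ^ 2 * ρ / 2) / (4 * ρ)) := by
  have hpi := Real.pi_pos
  rw [isEquivalent_iff_tendsto_one]
  swap
  · filter_upwards [eventually_gt_atTop 0] with ρ hρ
    positivity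
  have h1 := (intervalIntegral_tendsto_integral_Ioi 0 integrableOn_H tendsto_id).const_mul 4
  rw [integral_H_Ioi] at h1
  have h2 : Tendsto (fun ρ : ℝ => 4 * ρ * Real.exp (-(Real.pi ^ 2 / 2 * ρ))) atTop (𝓝 0) := by
    have h3 := Real.tendsto_pow_mul_exp_neg_atTop_nhds_zero 1
    have h4 := (h3.comp (tendsto_id.const_mul_atTop
      (show 0 < Real.pi ^ 2 / 2 by positivity))).const_mul (4 / (Real.pi ^ 2 / 2))
    rw [mul_zero] at h4
    refine h4.congr fun ρ => ?_
    simp only [Function.comp, id, pow_one]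
    field_simp
  have h5 := (h1.div tendsto_exp_mul_H one_ne_zero).sub h2
  norm_num at h5
  refine h5.congr' ?_
  filter_upwards [eventually_gt_atTop 0] with ρ hρ
  have hH := H_pos hρ
  simp only [Pi.div_apply, mu]
  rw [Real.exp_neg, show Real.pi ^ 2 / 2 * ρ = Real.pi ^ 2 * ρ / 2 by ring]
  have := Real.exp_pos (Real.pi ^ 2 * ρ / 2)
  field_simp

/-- With y = vρ, μ(ρ) + 1 is ∫₀¹ √ρ H(vρ) dv divided by √ρ H(ρ). The numerator tends to ∫₀¹ c
v^{-1/2} dv = 2c and the denominator to c. -/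
theorem tendsto_mu_zero : Tendsto mu (𝓝[>] 0) (𝓝 1) := by
  obtain ⟨c, hc, hlim⟩ := tendsto_sqrt_mul_H
  obtain ⟨δ, hδ, hbd⟩ : ∃ δ > 0, ∀ y ∈ Ioo (0 : ℝ) δ, √y * H y ≤ c + 1 := by
    have := hlim.eventually_le_const (show c < c + 1 by linarith)
    obtain ⟨δ, hδ, h⟩ := mem_nhdsGT_iff_exists_Ioo_subset.1 this
    exact ⟨δ, hδ, h⟩
  have hint : IntervalIntegrable (fun v : ℝ => v ^ (-(1 / 2) : ℝ)) volume 0 1 :=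
    intervalIntegral.intervalIntegrable_rpow' (by norm_num)
  have hmain : Tendsto (fun ρ : ℝ => ∫ v in (0 : ℝ)..1, √ρ * H (v * ρ)) (𝓝[>] 0)
      (𝓝 (∫ v in (0 : ℝ)..1, c * v ^ (-(1 / 2) : ℝ))) := by
    refine intervalIntegral.tendsto_integral_filter_of_dominated_convergence
      (fun v => (c + 1) * v ^ (-(1 / 2) : ℝ)) ?_ ?_ (hint.const_mul _) ?_
    · filter_upwards [self_mem_nhdsWithin] with ρ hρ
      rw [uIoc_of_le zero_le_one]
      exact ((intervalIntegrable_H_mul hρ).const_mul _).1.aestronglyMeasurable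
    · filter_upwards [Ioo_mem_nhdsGT hδ] with ρ hρ
      refine Eventually.of_forall fun v hv => ?_
      rw [uIoc_of_le zero_le_one] at hv
      have hv0 : 0 < v := hv.1
      have hH := H_pos (mul_pos hv0 hρ.1)
      rw [Real.norm_of_nonneg (by positivity)]
      have h1 := hbd (v * ρ) ⟨mul_pos hv0 hρ.1, by nlinarith [hv.2, hρ.1, hρ.2]⟩
      rw [Real.sqrt_mul hv0.le] at h1
      rw [Real.rpow_neg hv0.le, ← Real.sqrt_eq_rpow, ← div_eq_mul_inv,
        le_div_iff₀ (Real.sqrt_pos.2 hv0)]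
      linarith
    · refine Eventually.of_forall fun v hv => ?_
      rw [uIoc_of_le zero_le_one] at hv
      have hv0 : 0 < v := hv.1
      have hmul : Tendsto (fun ρ : ℝ => v * ρ) (𝓝[>] 0) (𝓝[>] 0) := by
        refine tendsto_nhdsWithin_iff.2 ⟨?_, ?_⟩
        · have : Tendsto (fun y : ℝ => v * y) (𝓝 0) (𝓝 (v * 0)) := tendsto_id.const_mul v
          rw [mul_zero] at this
          exact this.mono_left nhdsWithin_le_nhds
        · filter_upwards [self_mem_nhdsWithin] with y hy
          exact mul_pos hv0 hy
      refine ((hlim.comp hmul).mul_const (v ^ (-(1 / 2) : ℝ))).congr fun ρ => ?_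
      simp only [Function.comp]
      rw [Real.sqrt_mul hv0.le, Real.rpow_neg hv0.le, ← Real.sqrt_eq_rpow]
      have := Real.sqrt_pos.2 hv0
      field_simp
  have hval : ∫ v in (0 : ℝ)..1, c * v ^ (-(1 / 2) : ℝ) = 2 * c := by
    rw [intervalIntegral.integral_const_mul, integral_rpow (Or.inl (by norm_num))]
    norm_num
    ring
  rw [hval] at hmain
  have h := (hmain.div hlim hc.ne').sub_const 1
  rw [mul_div_assoc, div_self hc.ne'] at h
  norm_num at h
  refine h.congr' ?_
  filter_upwards [self_mem_nhdsWithin] with ρ hρ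
  have hρ0 : 0 < ρ := hρ
  have hH := H_pos hρ0
  simp only [mu]
  rw [integral_H_mul hρ0]
  have := Real.sqrt_pos.2 hρ0
  field_simp

/-! ### Asymptotics of the generating function of the hitting time -/

/-- Summation by parts trades the increments of the survival probability for its values, which have
a scaling limit. -/
theorem one_sub_hitGen {N : ℕ} (hN : 2 ≤ N) (w : ℝ) (M : ℕ) :
    1 - hitGen N w M 1 = 1 - w - (w - 1) * ∑ k ∈ Finset.range M, surv N k 1 * w ^ (k + 1) +
      surv N M 1 * w ^ (M + 1) := by
  have h0 : ¬ ((1 : ℤ) = 0 ∨ (1 : ℤ) = N) := by omega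
  rw [hitGen, if_neg h0]
  induction M with
  | zero => rw [surv_zero (by omega)]; simp
  | succ M ih =>
    rw [Finset.sum_range_succ, Finset.sum_range_succ]
    linear_combination ih

/-- Turns a sum into the integral of a step function, so that dominated convergence applies. -/
theorem integral_comp_floor (g : ℕ → ℝ) {M : ℕ} (hM : 0 < M) :
    ∫ v in (0 : ℝ)..1, g ⌊v * M⌋₊ = (1 / M : ℝ) * ∑ k ∈ Finset.range M, g k := by
  have hM' : (M : ℝ) ≠ 0 := by positivity
  have h1 := intervalIntegral.integral_comp_mul_right (a := 0) (b := 1)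
    (fun u : ℝ => g ⌊u⌋₊) hM'
  rw [h1, zero_mul, one_mul, smul_eq_mul, one_div]
  congr 1
  have hae : ∀ k : ℕ, ∀ᵐ u ∂(volume : Measure ℝ), u ∈ uIoc (k : ℝ) ((k + 1 : ℕ) : ℝ) →
      g ⌊u⌋₊ = g k := by
    intro k
    filter_upwards [compl_mem_ae_iff.2 (measure_singleton ((k + 1 : ℕ) : ℝ))] with u hu hmem
    rw [uIoc_of_le (by push_cast; linarith)] at hmem
    have hne : u ≠ ((k + 1 : ℕ) : ℝ) := hu
    congr 1
    rw [Nat.floor_eq_iff (by linarith [hmem.1, Nat.cast_nonneg (α := ℝ) k])]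
    refine ⟨hmem.1.le, ?_⟩
    have := lt_of_le_of_ne hmem.2 hne
    push_cast at this
    exact this
  have hint : ∀ k : ℕ, IntervalIntegrable (fun u : ℝ => g ⌊u⌋₊) volume k ((k + 1 : ℕ) : ℝ) := by
    intro k
    refine (intervalIntegrable_const (c := g k)).congr_ae ?_
    rw [EventuallyEq, ae_restrict_iff' measurableSet_uIoc]
    filter_upwards [hae k] with u hu hmem
    exact (hu hmem).symm
  have h2 := intervalIntegral.sum_integral_adjacent_intervals (f := fun u : ℝ => g ⌊u⌋₊)
    (a := fun k : ℕ => (k : ℝ)) (n := M) (fun k _ => hint k)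
  rw [Nat.cast_zero] at h2
  rw [← h2]
  refine Finset.sum_congr rfl fun k _ => ?_
  rw [intervalIntegral.integral_congr_ae (hae k)]
  simp

section Diffusive

variable {N : ℕ → ℕ} {ρ : ℝ}

theorem tendsto_div_capacity (hρ : 0 < ρ) (hN : Tendsto N atTop atTop)
    (hNρ : Tendsto (fun M : ℕ => (M : ℝ) / (N M : ℝ) ^ 2) atTop (𝓝 ρ)) :
    Tendsto (fun M : ℕ => (N M : ℝ) / M) atTop (𝓝 0) := by
  have hN' : Tendsto (fun M => (N M : ℝ)) atTop atTop := tendsto_natCast_atTop_atTop.comp hN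
  have h1 := (hNρ.inv₀ hρ.ne').mul (hN'.const_div_atTop 1)
  rw [mul_zero] at h1
  refine h1.congr' ?_
  filter_upwards [hN'.eventually_gt_atTop 0, eventually_gt_atTop 0] with M hM hM0
  field_simp

/-- An integrable majorant in v, independent of M and N. For n ≥ 1, vM < 2n gives n/N² ≥ vρ/4.
Weakening N/(n + 1) to N/√(n + 1) gives the v^{-1/2} term, which also covers n = 0. -/
theorem mul_surv_floor_le {M n : ℕ} {v : ℝ} (hρ : 0 < ρ) {N : ℕ} (hN : 0 < N)
    (hM : ρ / 2 ≤ (M : ℝ) / (N : ℝ) ^ 2) (hv : 0 < v) (hn : v * M < n + 1) :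
    N * surv N n 1 ≤ 4 * H (v * (ρ / Real.pi ^ 2)) + √(2 / ρ) * v ^ (-(1 / 2) : ℝ) := by
  have hpi := Real.pi_pos
  have hN' : (0 : ℝ) < N := by exact_mod_cast hN
  have hM0 : (0 : ℝ) < M := by
    rcases Nat.eq_zero_or_pos M with h | h
    · rw [h] at hM; simp at hM; linarith
    · exact_mod_cast h
  have hHpos : 0 < H (v * (ρ / Real.pi ^ 2)) := H_pos (by positivity)
  have hsq : (N : ℝ) / √(n + 1) ≤ √(2 / ρ) * v ^ (-(1 / 2) : ℝ) := by
    rw [Real.rpow_neg hv.le, ← Real.sqrt_eq_rpow, ← div_eq_mul_inv,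
      ← Real.sqrt_div' _ hv.le]
    refine Real.le_sqrt_of_sq_le ?_
    rw [div_pow, Real.sq_sqrt (by positivity), div_le_div_iff₀ (by positivity) hv, div_mul_eq_mul_div,
      le_div_iff₀ hρ]
    rw [le_div_iff₀ (by positivity)] at hM
    nlinarith
  have hle : (N : ℝ) / (n + 1) ≤ (N : ℝ) / √(n + 1) := by
    have h1 : (1 : ℝ) ≤ n + 1 := by linarith [Nat.cast_nonneg (α := ℝ) n]
    have h2 : √((n : ℝ) + 1) ≤ n + 1 := by
      rw [Real.sqrt_le_left (by linarith)]
      nlinarith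
    gcongr
  rcases Nat.eq_zero_or_pos n with h0 | h0
  · subst h0
    have := surv_le_one N 0 1
    have h3 : (N : ℝ) / √((0 : ℕ) + 1) = N := by simp
    rw [h3] at hsq
    nlinarith
  · have h1 : (1 : ℝ) ≤ n := by exact_mod_cast h0
    have := mul_surv_one_le hN h0
    have hH : H (4 / Real.pi ^ 2 * (n / N ^ 2)) ≤ H (v * (ρ / Real.pi ^ 2)) := by
      refine H_anti (by positivity) ?_
      rw [mul_div_assoc', div_mul_eq_mul_div, div_le_div_iff_of_pos_right (by positivity),
        mul_div_assoc', le_div_iff₀ (by positivity)]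
      rw [le_div_iff₀ (by positivity)] at hM
      nlinarith
    linarith

theorem tendsto_sum_surv (hρ : 0 < ρ) (hN : Tendsto N atTop atTop)
    (hNρ : Tendsto (fun M : ℕ => (M : ℝ) / (N M : ℝ) ^ 2) atTop (𝓝 ρ)) (s : ℝ) :
    Tendsto (fun M : ℕ => (1 / M : ℝ) * ∑ k ∈ Finset.range M,
      (N M * surv (N M) k 1) * Real.exp (s / M) ^ (k + 1)) atTop
      (𝓝 (∫ v in (0 : ℝ)..1, 4 * H (v * ρ) * Real.exp (s * v))) := by
  have hpi := Real.pi_pos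
  have hint : IntervalIntegrable (fun v : ℝ => v ^ (-(1 / 2) : ℝ)) volume 0 1 :=
    intervalIntegral.intervalIntegrable_rpow' (by norm_num)
  have hrat : ∀ v : ℝ, 0 < v → Tendsto (fun M : ℕ => (⌊v * M⌋₊ : ℝ) / M) atTop (𝓝 v) :=
    fun v hv => (tendsto_nat_floor_mul_div_atTop hv.le).comp tendsto_natCast_atTop_atTop
  have hlim : Tendsto (fun M : ℕ => ∫ v in (0 : ℝ)..1,
      (N M * surv (N M) ⌊v * M⌋₊ 1) * Real.exp (s / M) ^ (⌊v * M⌋₊ + 1)) atTop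
      (𝓝 (∫ v in (0 : ℝ)..1, 4 * H (v * ρ) * Real.exp (s * v))) := by
    refine intervalIntegral.tendsto_integral_filter_of_dominated_convergence
      (fun v => (4 * H (v * (ρ / Real.pi ^ 2)) + √(2 / ρ) * v ^ (-(1 / 2) : ℝ)) *
        Real.exp (2 * |s|)) ?_ ?_ ?_ ?_
    · refine Eventually.of_forall fun M => Measurable.aestronglyMeasurable ?_
      have : Measurable (fun n : ℕ => (N M * surv (N M) n 1) * Real.exp (s / M) ^ (n + 1)) :=
        Measurable.of_discrete
      exact this.comp (Nat.measurable_floor.comp (by fun_prop))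
    · filter_upwards [hNρ.eventually_const_le (show ρ / 2 < ρ by linarith),
        hN.eventually_gt_atTop 0, eventually_gt_atTop 0] with M hM hNM hM0
      refine Eventually.of_forall fun v hv => ?_
      rw [uIoc_of_le zero_le_one] at hv
      have hM0' : (0 : ℝ) < M := by exact_mod_cast hM0
      rw [Real.norm_of_nonneg (mul_nonneg (mul_nonneg (by positivity) (surv_nonneg _ _ _))
        (by positivity))]
      have h1 := mul_surv_floor_le hρ hNM hM hv.1 (Nat.lt_floor_add_one (v * M))
      -- The constant 2 bounds (⌊vM⌋ + 1)/M for v ≤ 1 and M ≥ 1.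
      have h2 : Real.exp (s / M) ^ (⌊v * M⌋₊ + 1) ≤ Real.exp (2 * |s|) := by
        rw [← Real.exp_nat_mul]
        refine Real.exp_le_exp.2 ?_
        have h3 : (⌊v * M⌋₊ : ℝ) ≤ v * M := Nat.floor_le (by have := hv.1; positivity)
        have h4 : ((⌊v * M⌋₊ + 1 : ℕ) : ℝ) / M ≤ 2 := by
          rw [div_le_iff₀ hM0']
          have : (1 : ℝ) ≤ M := by exact_mod_cast hM0
          push_cast
          nlinarith [hv.2]
        calc ((⌊v * M⌋₊ + 1 : ℕ) : ℝ) * (s / M) = ((⌊v * M⌋₊ + 1 : ℕ) : ℝ) / M * s := by ring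
          _ ≤ ((⌊v * M⌋₊ + 1 : ℕ) : ℝ) / M * |s| := by gcongr; exact le_abs_self s
          _ ≤ 2 * |s| := by gcongr
      refine mul_le_mul h1 h2 (by positivity) (le_trans ?_ h1)
      exact mul_nonneg (by positivity) (surv_nonneg _ _ _)
    · exact (((intervalIntegrable_H_mul (by positivity)).const_mul 4).add
        (hint.const_mul _)).mul_const _
    · refine Eventually.of_forall fun v hv => ?_
      rw [uIoc_of_le zero_le_one] at hv
      have hfl : Tendsto (fun M : ℕ => (⌊v * M⌋₊ : ℝ) / (N M : ℝ) ^ 2) atTop (𝓝 (v * ρ)) := by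
        refine ((hrat v hv.1).mul hNρ).congr' ?_
        filter_upwards [eventually_gt_atTop 0] with M hM
        field_simp
      refine (tendsto_mul_surv_one (mul_pos hv.1 hρ) hN hfl).mul ?_
      have h1 : Tendsto (fun M : ℕ => s * ((⌊v * M⌋₊ : ℝ) / M + 1 / M)) atTop
          (𝓝 (s * (v + 0))) :=
        ((hrat v hv.1).add tendsto_one_div_atTop_nhds_zero_nat).const_mul s
      rw [add_zero] at h1
      refine ((Real.continuous_exp.tendsto _).comp h1).congr fun M => ?_
      simp only [Function.comp]
      rw [← Real.exp_nat_mul]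
      congr 1
      push_cast
      ring
  refine hlim.congr' ?_
  filter_upwards [eventually_gt_atTop 0] with M hM
  exact integral_comp_floor
    (fun k => (N M * surv (N M) k 1) * Real.exp (s / M) ^ (k + 1)) hM

theorem tendsto_mul_exp_div_sub_one (s : ℝ) :
    Tendsto (fun M : ℕ => (M : ℝ) * (Real.exp (s / M) - 1)) atTop (𝓝 s) := by
  have hds : ContinuousAt (dslope Real.exp 0) 0 :=
    continuousAt_dslope_same.2 Real.differentiableAt_exp
  have h0 : Tendsto (fun M : ℕ => s / (M : ℝ)) atTop (𝓝 0) := tendsto_const_div_atTop_nhds_zero_nat s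
  have h := (hds.tendsto.comp h0).const_mul s
  rw [dslope_same, Real.deriv_exp, Real.exp_zero, mul_one] at h
  refine h.congr' ?_
  filter_upwards [eventually_gt_atTop 0] with M hM
  have hM' : (M : ℝ) ≠ 0 := by positivity
  have := sub_smul_dslope Real.exp 0 (s / M)
  rw [Real.exp_zero, smul_eq_mul, sub_zero] at this
  simp only [Function.comp]
  rw [← this]
  field_simp

theorem one_sub_G (hρ : 0 < ρ) (s : ℝ) :
    1 - G ρ s = Real.exp s - s / H ρ * ∫ v in (0 : ℝ)..1, H (v * ρ) * Real.exp (s * v) := by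
  have hH := H_pos hρ
  have hi1 : IntervalIntegrable (fun v => H (v * ρ) * Real.exp (s * v)) volume 0 1 :=
    (intervalIntegrable_H_mul hρ).mul_continuousOn (by fun_prop)
  have hi2 : IntervalIntegrable (fun v => H ρ * Real.exp (s * v)) volume 0 1 :=
    Continuous.intervalIntegrable (by fun_prop) _ _
  have e : ∀ v : ℝ, Real.exp (s * v) * (H (v * ρ) - H ρ) =
      H (v * ρ) * Real.exp (s * v) - H ρ * Real.exp (s * v) := fun v => by ring
  have hexp : s * ∫ v in (0 : ℝ)..1, Real.exp (s * v) = Real.exp s - 1 := by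
    rcases eq_or_ne s 0 with h | h
    · simp [h]
    · rw [intervalIntegral.integral_comp_mul_left _ h, integral_exp, smul_eq_mul,
        mul_inv_cancel_left₀ h]
      simp
  rw [G]
  simp_rw [e]
  rw [intervalIntegral.integral_sub hi1 hi2, intervalIntegral.integral_const_mul]
  have : s / H ρ * (H ρ * ∫ v in (0 : ℝ)..1, Real.exp (s * v)) = Real.exp s - 1 := by
    rw [← hexp]; field_simp
  rw [mul_sub, this]
  ring

theorem tendsto_mul_surv_capacity (hρ : 0 < ρ) (hN : Tendsto N atTop atTop)
    (hNρ : Tendsto (fun M : ℕ => (M : ℝ) / (N M : ℝ) ^ 2) atTop (𝓝 ρ)) :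
    Tendsto (fun M : ℕ => N M * surv (N M) M 1) atTop (𝓝 (4 * H ρ)) :=
  tendsto_mul_surv_one (n := fun M => M) hρ hN hNρ

theorem eventually_surv_pos (hρ : 0 < ρ) (hN : Tendsto N atTop atTop)
    (hNρ : Tendsto (fun M : ℕ => (M : ℝ) / (N M : ℝ) ^ 2) atTop (𝓝 ρ)) :
    ∀ᶠ M : ℕ in atTop, 0 < surv (N M) M 1 := by
  have hH := H_pos hρ
  filter_upwards [(tendsto_mul_surv_capacity hρ hN hNρ).eventually_const_lt
    (show 0 < 4 * H ρ by positivity)] with M hM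
  exact pos_of_mul_pos_right hM (by positivity)

/-- The key limit: `(1 - E[e^{s(τ+1)/M}; τ ≤ M]) / P(τ > M) → 1 - G(ρ, s)`. -/
theorem tendsto_one_sub_hitGen_div (hρ : 0 < ρ) (hN : Tendsto N atTop atTop)
    (hNρ : Tendsto (fun M : ℕ => (M : ℝ) / (N M : ℝ) ^ 2) atTop (𝓝 ρ)) (s : ℝ) :
    Tendsto (fun M : ℕ => (1 - hitGen (N M) (Real.exp (s / M)) M 1) / surv (N M) M 1) atTop
      (𝓝 (1 - G ρ s)) := by
  have hH := H_pos hρ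
  have hq := tendsto_mul_surv_capacity hρ hN hNρ
  have hexp := tendsto_mul_exp_div_sub_one s
  -- These are the three terms of the summation by parts, all multiplied by N; the first vanishes
  -- since N/M → 0.
  have h1 := ((tendsto_div_capacity hρ hN hNρ).mul hexp).neg
  have h2 := hexp.mul (tendsto_sum_surv hρ hN hNρ s)
  have h3 : Tendsto (fun M : ℕ => Real.exp (s * (1 + 1 / M))) atTop (𝓝 (Real.exp (s * (1 + 0)))) :=
    (Real.continuous_exp.tendsto _).comp
      ((tendsto_one_div_atTop_nhds_zero_nat.const_add 1).const_mul s)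
  have hnum := (h1.sub h2).add (hq.mul h3)
  have h := hnum.div hq (by positivity)
  have he : (-(0 * s) - s * (∫ v in (0 : ℝ)..1, 4 * H (v * ρ) * Real.exp (s * v)) +
      4 * H ρ * Real.exp (s * (1 + 0))) / (4 * H ρ) = 1 - G ρ s := by
    rw [one_sub_G hρ]
    simp_rw [mul_assoc (4 : ℝ)]
    rw [intervalIntegral.integral_const_mul]
    generalize ∫ v in (0 : ℝ)..1, H (v * ρ) * Real.exp (s * v) = J
    field_simp
    ring_nf
  rw [he] at h
  refine h.congr' ?_
  filter_upwards [hN.eventually_ge_atTop 2, eventually_gt_atTop 0,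
    eventually_surv_pos hρ hN hNρ] with M hNM hM hqM
  have hM' : (M : ℝ) ≠ 0 := by positivity
  have hNM' : (N M : ℝ) ≠ 0 := by
    have : N M ≠ 0 := by omega
    exact_mod_cast this
  rw [one_sub_hitGen hNM]
  have e1 : Real.exp (s * (1 + 1 / M)) = Real.exp (s / M) ^ (M + 1) := by
    rw [← Real.exp_nat_mul]; congr 1; push_cast; field_simp
  have e2 : ∑ k ∈ Finset.range M, (N M * surv (N M) k 1) * Real.exp (s / M) ^ (k + 1) =
      N M * ∑ k ∈ Finset.range M, surv (N M) k 1 * Real.exp (s / M) ^ (k + 1) := by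
    rw [Finset.mul_sum]
    exact Finset.sum_congr rfl fun k _ => by ring
  simp only [Pi.div_apply]
  rw [e1, e2]
  field_simp
  ring

end Diffusive

/-! ### The limiting Laplace transform -/

/-- The exponents below some `s' > 0` with `G(ρ, s') < 1`. -/
def expDomain (ρ : ℝ) : Set ℝ := {s | ∃ s', s < s' ∧ 0 < s' ∧ G ρ s' < 1}

theorem isOpen_expDomain (ρ : ℝ) : IsOpen (expDomain ρ) := by
  have : expDomain ρ = ⋃ s' ∈ {s' | 0 < s' ∧ G ρ s' < 1}, Iio s' := by
    ext s
    simp only [expDomain, mem_ofPred_eq, mem_iUnion, mem_Iio, exists_prop]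
    exact ⟨fun ⟨a, h1, h2⟩ => ⟨a, h2, h1⟩, fun ⟨a, h2, h1⟩ => ⟨a, h1, h2⟩⟩
  rw [this]
  exact isOpen_biUnion fun s' _ => isOpen_Iio

/-- The difference quotient `G(ρ, s) / s`. -/
noncomputable def slopeG (ρ s : ℝ) : ℝ :=
  1 / H ρ * ∫ v in (0 : ℝ)..1, Real.exp (s * v) * (H (v * ρ) - H ρ)

theorem G_eq_mul_slopeG (ρ s : ℝ) : G ρ s = s * slopeG ρ s := by
  unfold G slopeG; ring

theorem intervalIntegrable_H_sub {ρ : ℝ} (hρ : 0 < ρ) :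
    IntervalIntegrable (fun v => H (v * ρ) - H ρ) volume 0 1 :=
  (intervalIntegrable_H_mul hρ).sub intervalIntegrable_const

theorem intervalIntegrable_exp_mul_H_sub {ρ : ℝ} (hρ : 0 < ρ) (s : ℝ) :
    IntervalIntegrable (fun v => Real.exp (s * v) * (H (v * ρ) - H ρ)) volume 0 1 :=
  (intervalIntegrable_H_sub hρ).continuousOn_mul (by fun_prop)

theorem H_sub_nonneg {ρ v : ℝ} (hρ : 0 < ρ) (hv0 : 0 < v) (hv1 : v ≤ 1) :
    0 ≤ H (v * ρ) - H ρ :=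
  sub_nonneg.2 (H_anti (mul_pos hv0 hρ) (by nlinarith))

theorem slopeG_mono {ρ : ℝ} (hρ : 0 < ρ) : Monotone (slopeG ρ) := by
  intro s t hst
  have hH := H_pos hρ
  refine mul_le_mul_of_nonneg_left ?_ (by positivity)
  refine intervalIntegral.integral_mono_on_of_le_Ioo zero_le_one
    (intervalIntegrable_exp_mul_H_sub hρ s) (intervalIntegrable_exp_mul_H_sub hρ t) fun v hv => ?_
  refine mul_le_mul_of_nonneg_right (Real.exp_le_exp.2 ?_) (H_sub_nonneg hρ hv.1 hv.2.le)
  exact mul_le_mul_of_nonneg_right hst hv.1.le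

theorem slopeG_nonneg {ρ : ℝ} (hρ : 0 < ρ) (s : ℝ) : 0 ≤ slopeG ρ s := by
  have hH := H_pos hρ
  refine mul_nonneg (by positivity) ?_
  have := intervalIntegral.integral_mono_on_of_le_Ioo zero_le_one
    (intervalIntegrable_const (c := (0 : ℝ)) (μ := volume))
    (intervalIntegrable_exp_mul_H_sub hρ s)
    (fun v hv => mul_nonneg (Real.exp_pos _).le (H_sub_nonneg hρ hv.1 hv.2.le))
  simpa using this

/-- G is s times a nonnegative nondecreasing function, so it is nonpositive for s ≤ 0 and
nondecreasing for s ≥ 0. -/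
theorem G_lt_one {ρ s : ℝ} (hρ : 0 < ρ) (hs : s ∈ expDomain ρ) : G ρ s < 1 := by
  obtain ⟨t, hst, ht, hG⟩ := hs
  rw [G_eq_mul_slopeG] at hG ⊢
  rcases le_total s 0 with h | h
  · nlinarith [slopeG_nonneg hρ s]
  · have h1 := slopeG_mono hρ hst.le
    have h2 := slopeG_nonneg hρ s
    nlinarith

theorem continuousAt_slopeG {ρ : ℝ} (hρ : 0 < ρ) : ContinuousAt (slopeG ρ) 0 := by
  refine ContinuousAt.mul continuousAt_const ?_
  refine intervalIntegral.continuousAt_of_dominated_interval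
    (bound := fun v => Real.exp 1 * (H (v * ρ) - H ρ)) ?_ ?_
    ((intervalIntegrable_H_sub hρ).const_mul _) ?_
  · refine Eventually.of_forall fun s => ?_
    rw [uIoc_of_le zero_le_one]
    exact (intervalIntegrable_exp_mul_H_sub hρ s).1.aestronglyMeasurable
  · filter_upwards [Iio_mem_nhds zero_lt_one] with s hs
    refine Eventually.of_forall fun v hv => ?_
    rw [uIoc_of_le zero_le_one] at hv
    have h0 := H_sub_nonneg hρ hv.1 hv.2
    rw [Real.norm_of_nonneg (by positivity)]
    refine mul_le_mul_of_nonneg_right (Real.exp_le_exp.2 ?_) h0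
    have hs' : s < 1 := hs
    nlinarith [hv.1, hv.2]
  · exact Eventually.of_forall fun v _ => by fun_prop

theorem slopeG_zero {ρ : ℝ} (hρ : 0 < ρ) : slopeG ρ 0 = mu ρ := by
  have hH := H_pos hρ
  unfold slopeG mu
  simp_rw [zero_mul, Real.exp_zero, one_mul]
  rw [intervalIntegral.integral_sub (intervalIntegrable_H_mul hρ) intervalIntegrable_const,
    integral_H_mul hρ]
  simp only [intervalIntegral.integral_const, sub_zero, smul_eq_mul, one_mul]
  field_simp

theorem zero_mem_expDomain {ρ : ℝ} (hρ : 0 < ρ) : (0 : ℝ) ∈ expDomain ρ := by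
  have h : Tendsto (fun s => s * slopeG ρ s) (𝓝 0) (𝓝 (0 * slopeG ρ 0)) :=
    tendsto_id.mul (continuousAt_slopeG hρ).tendsto
  rw [zero_mul] at h
  obtain ⟨s, hs, hs0⟩ := ((h.eventually_lt_const zero_lt_one).filter_mono
    (nhdsWithin_le_nhds (s := Ioi 0)) |>.and self_mem_nhdsWithin).exists
  exact ⟨s, hs0, hs0, by rwa [G_eq_mul_slopeG]⟩

/-- Only nonemptiness of the set under the supremum enters, so its boundedness need not be known. -/
theorem mem_expDomain_of_lt_sMax {ρ s : ℝ} (hρ : 0 < ρ) (hs : s < sMax ρ) : s ∈ expDomain ρ := by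
  obtain ⟨t, -, ht⟩ := zero_mem_expDomain hρ
  obtain ⟨u, hu, hsu⟩ := exists_lt_of_lt_csSup ⟨t, ht⟩ hs
  exact ⟨u, hsu, hu⟩

theorem phi_pos {ρ s : ℝ} (hρ : 0 < ρ) (hs : s ∈ expDomain ρ) : 0 < phi ρ s :=
  one_div_pos.2 (by linarith [G_lt_one hρ hs])

/-- The difference quotient of G at 0 is `slopeG`, continuous there with value μ(ρ); as G(ρ, 0) = 0,
φ has the same derivative as G. -/
theorem hasDerivAt_phi {ρ : ℝ} (hρ : 0 < ρ) : HasDerivAt (phi ρ) (mu ρ) 0 := by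
  have hG : HasDerivAt (G ρ) (mu ρ) 0 := by
    rw [hasDerivAt_iff_tendsto_slope_zero]
    have h := (continuousAt_slopeG hρ).tendsto.mono_left (nhdsWithin_le_nhds (s := {0}ᶜ))
    rw [slopeG_zero hρ] at h
    refine h.congr' ?_
    filter_upwards [self_mem_nhdsWithin] with s hs
    have hs' : s ≠ 0 := hs
    rw [zero_add, G_eq_mul_slopeG, G_eq_mul_slopeG, zero_mul, sub_zero, smul_eq_mul,
      inv_mul_cancel_left₀ hs']
  have h0 : G ρ 0 = 0 := by rw [G_eq_mul_slopeG, zero_mul]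
  have h1 : HasDerivAt (fun s => 1 - G ρ s) (-mu ρ) 0 := 
    hG.const_sub 1
  have h2 := h1.inv (by rw [h0]; norm_num)
  rw [h0] at h2
  norm_num at h2
  refine h2.congr_of_eventuallyEq (Eventually.of_forall fun s => ?_)
  simp [phi]

/-! ### Convergence of the Laplace transforms -/

section Diffusive

variable {N : ℕ → ℕ} {ρ : ℝ}

theorem tendsto_surv_div (hρ : 0 < ρ) (hN : Tendsto N atTop atTop)
    (hNρ : Tendsto (fun M : ℕ => (M : ℝ) / (N M : ℝ) ^ 2) atTop (𝓝 ρ)) {s : ℝ}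
    (hs : s ∈ expDomain ρ) :
    (∀ᶠ M : ℕ in atTop, hitGen (N M) (Real.exp (s / M)) M 1 < 1) ∧
    Tendsto (fun M : ℕ => surv (N M) M 1 / (1 - hitGen (N M) (Real.exp (s / M)) M 1)) atTop
      (𝓝 (phi ρ s)) := by
  have h := tendsto_one_sub_hitGen_div hρ hN hNρ s
  have hG : 0 < 1 - G ρ s := by linarith [G_lt_one hρ hs]
  constructor
  · filter_upwards [h.eventually_const_lt hG, eventually_surv_pos hρ hN hNρ] with M hM hq
    have := (div_pos_iff_of_pos_right hq).1 hM
    linarith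
  · have h1 := h.inv₀ hG.ne'
    rw [phi, one_div]
    exact h1.congr fun M => inv_div _ _

/-- The limit law and all its convolution roots arise as weak limits of negative binomial compounds
of `hitLaw`. -/
theorem exists_laplace_eq_phi_rpow_of_seq (hρ : 0 < ρ) (hN : Tendsto N atTop atTop)
    (hNρ : Tendsto (fun M : ℕ => (M : ℝ) / (N M : ℝ) ^ 2) atTop (𝓝 ρ)) {α : ℝ} (hα : 0 < α) :
    ∃ κ : ProbabilityMeasure ℝ, ∀ s ∈ expDomain ρ,
      laplace κ s = ENNReal.ofReal (phi ρ s ^ α) := by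
  have hex : ∀ M : ℕ, ∃ κ : ProbabilityMeasure ℝ, 2 ≤ N M → 0 < surv (N M) M 1 →
      ∀ s : ℝ, hitGen (N M) (Real.exp (s / M)) M 1 < 1 → laplace κ s =
        ENNReal.ofReal ((surv (N M) M 1 / (1 - hitGen (N M) (Real.exp (s / M)) M 1)) ^ α) := by
    intro M
    by_cases h : 2 ≤ N M ∧ 0 < surv (N M) M 1
    · obtain ⟨κ, hκ⟩ := exists_laplace_eq_rpow (hitLaw (N M) M) h.2 (surv_le_one _ _ _) hα
        (hitLaw_univ h.1 M)
      exact ⟨κ, fun _ _ s hs => hκ s _ (hitGen_nonneg _ (Real.exp_pos _).le _ _) hs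
        (laplace_hitLaw h.1 M s)⟩
    · exact ⟨⟨Measure.dirac 0, inferInstance⟩, fun h1 h2 => absurd ⟨h1, h2⟩ h⟩
  choose κ hκ using hex
  obtain ⟨ν, -, hν⟩ := exists_tendsto_of_tendsto_laplace (μ := κ) (isOpen_expDomain ρ)
    (zero_mem_expDomain hρ) (φ := fun s => phi ρ s ^ α) (fun s hs => by
      obtain ⟨h1, h2⟩ := tendsto_surv_div hρ hN hNρ hs
      have h3 := ENNReal.tendsto_ofReal (h2.rpow_const (p := α) (Or.inr hα.le))
      refine h3.congr' ?_
      filter_upwards [h1, hN.eventually_ge_atTop 2, eventually_surv_pos hρ hN hNρ] with M a b c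
      exact (hκ M b c s a).symm)
  exact ⟨ν, hν⟩

theorem measurable_lifetime_div (N M : ℕ) :
    Measurable (fun ζ : ℕ → State => ((lifetime N ζ).toNat : ℝ) / (M : ℝ)) := by
  have : Measurable (fun k : ℕ∞ => ((k.toNat : ℕ) : ℝ) / (M : ℝ)) := Measurable.of_discrete
  exact this.comp (measurable_lifetime N)

/-- The law of the rescaled lifetime. -/
noncomputable def lifetimeLaw (N M : ℕ) : ProbabilityMeasure ℝ :=
  -- `toNat` sends ⊤ to 0, which is immaterial once the lifetime is almost surely finite.
  ⟨(chainLaw N M (1, M)).map (fun ζ => ((lifetime N ζ).toNat : ℝ) / (M : ℝ)),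
    Measure.isProbabilityMeasure_map (measurable_lifetime_div N M).aemeasurable⟩

theorem lintegral_lifetimeLaw {N M : ℕ} (hN : 2 ≤ N) (hq : 0 < surv N M 1) {f : ℝ → ℝ≥0∞}
    (hf : Measurable f) :
    ∫⁻ x, f x ∂(lifetimeLaw N M : Measure ℝ) =
      ∑' n : ℕ, lifetimeProb N M n (1, M) * f ((n : ℝ) / M) := by
  change ∫⁻ x, f x ∂((chainLaw N M (1, M)).map _) = _
  rw [lintegral_map hf (measurable_lifetime_div N M)]
  rw [(lintegral_lifetime (tsum_lifetimeProb_eq_one hN hq)).2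
    (fun k => f (((k.toNat : ℕ) : ℝ) / M))]
  simp

theorem laplace_lifetimeLaw {N M : ℕ} (hN : 2 ≤ N) (hM : 0 < M) (hq : 0 < surv N M 1) {s : ℝ}
    (hA : hitGen N (Real.exp (s / M)) M 1 < 1) :
    laplace (lifetimeLaw N M) s = ENNReal.ofReal
      (Real.exp s * (surv N M 1 / (1 - hitGen N (Real.exp (s / M)) M 1))) := by
  have hM' : (M : ℝ) ≠ 0 := by positivity
  have h := tsum_lifetimeProb (M := M) hN (Real.exp_pos (s / M)).le hA
  have e : Real.exp (s / M) ^ M = Real.exp s := by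
    rw [← Real.exp_nat_mul, mul_div_cancel₀ _ hM']
  rw [e, mul_div_assoc] at h
  rw [← h, laplace, lintegral_lifetimeLaw hN hq (by fun_prop)]
  refine tsum_congr fun n => ?_
  rw [← ENNReal.ofReal_pow (Real.exp_pos _).le, ← Real.exp_nat_mul]
  congr 3
  ring

theorem tendsto_laplace_lifetimeLaw (hρ : 0 < ρ) (hN : Tendsto N atTop atTop)
    (hNρ : Tendsto (fun M : ℕ => (M : ℝ) / (N M : ℝ) ^ 2) atTop (𝓝 ρ)) {s : ℝ}
    (hs : s ∈ expDomain ρ) :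
    Tendsto (fun M => laplace (lifetimeLaw (N M) M) s) atTop
      (𝓝 (ENNReal.ofReal (Real.exp s * phi ρ s))) := by
  obtain ⟨h1, h2⟩ := tendsto_surv_div hρ hN hNρ hs
  refine (ENNReal.tendsto_ofReal (h2.const_mul (Real.exp s))).congr' ?_
  filter_upwards [h1, hN.eventually_ge_atTop 2, eventually_surv_pos hρ hN hNρ,
    eventually_gt_atTop 0] with M a b c d
  exact (laplace_lifetimeLaw b d c a).symm

end Diffusive

/-! ### The limit law: existence, mean, and convergence of the lifetime. -/

theorem exists_seq_div_sq_tendsto {ρ : ℝ} (hρ : 0 < ρ) : ∃ N : ℕ → ℕ, Tendsto N atTop atTop ∧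
    Tendsto (fun M : ℕ => (M : ℝ) / (N M : ℝ) ^ 2) atTop (𝓝 ρ) := by
  have hx : Tendsto (fun M : ℕ => √((M : ℝ) / ρ)) atTop atTop :=
    Real.tendsto_sqrt_atTop.comp (tendsto_natCast_atTop_atTop.atTop_div_const hρ)
  refine ⟨fun M => ⌈√((M : ℝ) / ρ)⌉₊, tendsto_nat_ceil_atTop.comp hx, ?_⟩
  have h1 : Tendsto (fun M : ℕ => (⌈√((M : ℝ) / ρ)⌉₊ : ℝ) / √((M : ℝ) / ρ)) atTop (𝓝 1) :=
    (tendsto_nat_ceil_div_atTop (R := ℝ)).comp hx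
  have h2 := ((h1.inv₀ one_ne_zero).pow 2).const_mul ρ
  rw [inv_one, one_pow, mul_one] at h2
  refine h2.congr' ?_
  filter_upwards [eventually_gt_atTop 0] with M hM
  have hM' : (0 : ℝ) < M := by exact_mod_cast hM
  rw [inv_div, div_pow, Real.sq_sqrt (by positivity)]
  field_simp

/-- One auxiliary sequence is enough to construct the law, which therefore depends on ρ alone and
not on the sequence in the theorem. -/
theorem exists_laplace_eq_phi_rpow {ρ α : ℝ} (hρ : 0 < ρ) (hα : 0 < α) :
    ∃ κ : ProbabilityMeasure ℝ, ∀ s ∈ expDomain ρ,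
      laplace κ s = ENNReal.ofReal (phi ρ s ^ α) := by
  obtain ⟨N, hN, hNρ⟩ := exists_seq_div_sq_tendsto hρ
  exact exists_laplace_eq_phi_rpow_of_seq hρ hN hNρ hα

theorem integrable_and_integral_eq_mu {ρ : ℝ} (hρ : 0 < ρ) {ν : ProbabilityMeasure ℝ}
    (hν : ∀ s ∈ expDomain ρ, laplace ν s = ENNReal.ofReal (phi ρ s)) :
    Integrable (fun x : ℝ => x) (ν : Measure ℝ) ∧ ∫ x, x ∂(ν : Measure ℝ) = mu ρ := by
  have hsub : expDomain ρ ⊆ integrableExpSet id (ν : Measure ℝ) := fun s hs =>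
    (integrable_exp_iff _ s).2 (by rw [hν s hs]; simp)
  have hint : (0 : ℝ) ∈ interior (integrableExpSet id (ν : Measure ℝ)) :=
    interior_maximal hsub (isOpen_expDomain ρ) (zero_mem_expDomain hρ)
  refine ⟨by simpa using integrable_pow_of_mem_interior_integrableExpSet hint 1, ?_⟩
  have h1 := deriv_mgf_zero hint
  have h2 : mgf id (ν : Measure ℝ) =ᶠ[𝓝 0] phi ρ := by
    filter_upwards [(isOpen_expDomain ρ).mem_nhds (zero_mem_expDomain hρ)] with s hs
    rw [mgf_eq_toReal_laplace (by rw [hν s hs]; simp), hν s hs,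
      ENNReal.toReal_ofReal (phi_pos hρ hs).le]
  rw [h2.deriv_eq, (hasDerivAt_phi hρ).deriv] at h1
  exact h1.symm

theorem tendsto_lifetimeLaw {ρ : ℝ} (hρ : 0 < ρ) {ν : ProbabilityMeasure ℝ}
    (hν : ∀ s ∈ expDomain ρ, laplace ν s = ENNReal.ofReal (phi ρ s)) {N : ℕ → ℕ}
    (hN : Tendsto N atTop atTop)
    (hNρ : Tendsto (fun M : ℕ => (M : ℝ) / (N M : ℝ) ^ 2) atTop (𝓝 ρ)) :
    Tendsto (fun M => lifetimeLaw (N M) M) atTop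
      (𝓝 (ν.map (f := fun x : ℝ => 1 + x) (by fun_prop))) := by
  obtain ⟨ν', hlim, hν'⟩ := exists_tendsto_of_tendsto_laplace (isOpen_expDomain ρ)
    (zero_mem_expDomain hρ) (fun s hs => tendsto_laplace_lifetimeLaw hρ hN hNρ hs)
  have : ν' = ν.map (f := fun x : ℝ => 1 + x) (by fun_prop) := by
    refine ext_of_laplace_eq (isOpen_expDomain ρ) (zero_mem_expDomain hρ)
      (fun s hs => by rw [hν' s hs]; simp) fun s hs => ?_
    rw [hν' s hs, ProbabilityMeasure.toMeasure_map, laplace_map_const_add, hν s hs, mul_one,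
      ENNReal.ofReal_mul (Real.exp_pos _).le]
  rwa [← this]

theorem tendsto_mean_lifetimeLaw {ρ : ℝ} (hρ : 0 < ρ) {ν : ProbabilityMeasure ℝ}
    (hν : ∀ s ∈ expDomain ρ, laplace ν s = ENNReal.ofReal (phi ρ s)) {N : ℕ → ℕ}
    (hN : Tendsto N atTop atTop)
    (hNρ : Tendsto (fun M : ℕ => (M : ℝ) / (N M : ℝ) ^ 2) atTop (𝓝 ρ)) :
    Tendsto (fun M => ∫⁻ x, ENNReal.ofReal (max x 0) ∂(lifetimeLaw (N M) M : Measure ℝ)) atTop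
      (𝓝 (ENNReal.ofReal (1 + mu ρ))) := by
  have hlim := tendsto_lifetimeLaw hρ hν hN hNρ
  set ν' := ν.map (f := fun x : ℝ => 1 + x) (by fun_prop) with hν'
  have hlap := fun s (hs : s ∈ expDomain ρ) => tendsto_laplace_lifetimeLaw hρ hN hNρ hs
  obtain ⟨hint, hmean⟩ := integrable_and_integral_eq_mu hρ hν
  -- The negative parts have expectation 0 along the sequence, so the limit law lives on [0, ∞) and
  -- its mean is the lower integral of the positive part.
  have hneg := tendsto_lintegral_of_le_abs hlim (isOpen_expDomain ρ) (zero_mem_expDomain hρ) hlap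
    (f := fun x => max (-x) 0) (by fun_prop) (fun x => le_max_right _ _)
    (fun x => max_le (neg_le_abs x) (abs_nonneg x))
  have hpos := tendsto_lintegral_of_le_abs hlim (isOpen_expDomain ρ) (zero_mem_expDomain hρ) hlap
    (f := fun x => max x 0) (by fun_prop) (fun x => le_max_right _ _)
    (fun x => max_le (le_abs_self x) (abs_nonneg x))
  have hzero : ∀ M : ℕ,
      ∫⁻ x, ENNReal.ofReal (max (-x) 0) ∂(lifetimeLaw (N M) M : Measure ℝ) = 0 := by
    intro M
    change ∫⁻ x, ENNReal.ofReal (max (-x) 0) ∂((chainLaw (N M) M (1, M)).map _) = 0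
    rw [lintegral_map (by fun_prop) (measurable_lifetime_div _ _)]
    refine (lintegral_congr fun ζ => ?_).trans lintegral_zero
    have : 0 ≤ ((lifetime (N M) ζ).toNat : ℝ) / M := by positivity
    rw [max_eq_right (by linarith), ENNReal.ofReal_zero]
  simp_rw [hzero] at hneg
  have h0 := tendsto_nhds_unique tendsto_const_nhds hneg
  have hae : ∀ᵐ x ∂(ν' : Measure ℝ), 0 ≤ x := by
    have := (lintegral_eq_zero_iff (by fun_prop)).1 h0.symm
    filter_upwards [this] with x hx
    have h1 : max (-x) 0 ≤ 0 := ENNReal.ofReal_eq_zero.1 hx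
    linarith [le_max_left (-x) 0]
  have hint' : Integrable (fun x : ℝ => x) (ν' : Measure ℝ) := by
    rw [hν', ProbabilityMeasure.toMeasure_map, integrable_map_measure (by fun_prop) (by fun_prop)]
    exact (integrable_const 1).add hint
  have hval : ∫ x, x ∂(ν' : Measure ℝ) = 1 + mu ρ := by
    rw [hν', ProbabilityMeasure.toMeasure_map, integral_map (by fun_prop) (by fun_prop),
      integral_add (integrable_const 1) hint, hmean]
    simp
  rw [← hval, ofReal_integral_eq_lintegral_ofReal hint' hae]
  refine hpos.trans (le_of_eq (congrArg 𝓝 (lintegral_congr_ae ?_)))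
  filter_upwards [hae] with x hx
  rw [max_eq_left hx]

theorem lintegral_lifetime_div {N M : ℕ} (hN : 2 ≤ N) (hM : 0 < M) (hq : 0 < surv N M 1) :
    (∫⁻ ζ, (lifetime N ζ : ℝ≥0∞) ∂(chainLaw N M (1, M))) / (M : ℝ≥0∞) =
      ∫⁻ x, ENNReal.ofReal (max x 0) ∂(lifetimeLaw N M : Measure ℝ) := by
  rw [lintegral_lifetimeLaw hN hq (by fun_prop),
    (lintegral_lifetime (tsum_lifetimeProb_eq_one hN hq)).2 (fun k => (k : ℝ≥0∞)),
    div_eq_mul_inv, ← ENNReal.tsum_mul_right]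
  refine tsum_congr fun n => ?_
  have hM' : (0 : ℝ) < M := by exact_mod_cast hM
  rw [max_eq_left (by positivity), ENNReal.ofReal_div_of_pos hM', div_eq_mul_inv, mul_assoc]
  simp

end EnergyWalk

theorem mainTheorem3 :
    (∀ ρ : ℝ, 0 < ρ →
      ∃ ν : ProbabilityMeasure ℝ,
        EnergyWalk.IsInfinitelyDivisible ν ∧
        (∀ s : ℝ, s < EnergyWalk.sMax ρ →
          Integrable (fun x : ℝ => Real.exp (s * x)) (ν : Measure ℝ) ∧
          ∫ x, Real.exp (s * x) ∂(ν : Measure ℝ) = EnergyWalk.phi ρ s) ∧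
        Integrable (fun x : ℝ => x) (ν : Measure ℝ) ∧
        ∫ x, x ∂(ν : Measure ℝ) = EnergyWalk.mu ρ ∧
        ∀ N : ℕ → ℕ, (∀ M : ℕ, 1 ≤ M → 2 ≤ N M) →
          Tendsto N atTop atTop →
          Tendsto (fun M : ℕ => (M : ℝ) / (N M : ℝ) ^ 2) atTop (𝓝 ρ) →
          (∀ᶠ M : ℕ in atTop, ∀ᵐ ζ ∂(EnergyWalk.chainLaw (N M) M (1, M)),
            EnergyWalk.lifetime (N M) ζ ≠ ⊤) ∧
          TendstoInDistribution
            (fun (M : ℕ) (ζ : ℕ → EnergyWalk.State) =>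
              ((EnergyWalk.lifetime (N M) ζ).toNat : ℝ) / (M : ℝ))
            atTop (fun x : ℝ => 1 + x)
            (fun M : ℕ => EnergyWalk.chainLaw (N M) M (1, M)) (ν : Measure ℝ) ∧
          Tendsto
            (fun M : ℕ =>
              (∫⁻ ζ, (EnergyWalk.lifetime (N M) ζ : ℝ≥0∞)
                ∂(EnergyWalk.chainLaw (N M) M (1, M))) / (M : ℝ≥0∞))
            atTop (𝓝 (ENNReal.ofReal (1 + EnergyWalk.mu ρ)))) ∧
    Tendsto EnergyWalk.mu (𝓝[>] 0) (𝓝 1) ∧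
    EnergyWalk.mu ~[atTop] (fun ρ : ℝ => Real.exp (Real.pi ^ 2 * ρ / 2) / (4 * ρ)) := by
  refine ⟨fun ρ hρ => ?_, EnergyWalk.tendsto_mu_zero, EnergyWalk.tendsto_mu_atTop⟩
  -- The exponent α = 1 gives the law of ξ_ρ itself; α = 1/n below gives its roots.
  obtain ⟨ν, hν⟩ := EnergyWalk.exists_laplace_eq_phi_rpow hρ one_pos
  simp_rw [Real.rpow_one] at hν
  obtain ⟨hint, hmean⟩ := EnergyWalk.integrable_and_integral_eq_mu hρ hν
  refine ⟨ν, ?_, fun s hs => ?_, hint, hmean, fun N _ hN hNρ => ⟨?_, ?_, ?_⟩⟩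
  · exact EnergyWalk.isInfinitelyDivisible_of_laplace_rpow (EnergyWalk.isOpen_expDomain ρ)
      (EnergyWalk.zero_mem_expDomain hρ) (fun s hs => (EnergyWalk.phi_pos hρ hs).le) hν
      fun n hn => EnergyWalk.exists_laplace_eq_phi_rpow hρ
        (one_div_pos.2 (Nat.cast_pos.2 hn))
  · have hsI := EnergyWalk.mem_expDomain_of_lt_sMax hρ hs
    have hfin : EnergyWalk.laplace ν s < ∞ := by rw [hν s hsI]; simp
    refine ⟨(EnergyWalk.integrable_exp_iff _ s).2 hfin, ?_⟩
    have := EnergyWalk.mgf_eq_toReal_laplace hfin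
    rw [hν s hsI, ENNReal.toReal_ofReal (EnergyWalk.phi_pos hρ hsI).le] at this
    exact this
  · filter_upwards [hN.eventually_ge_atTop 2, EnergyWalk.eventually_surv_pos hρ hN hNρ] with M a b
    exact (EnergyWalk.lintegral_lifetime (EnergyWalk.tsum_lifetimeProb_eq_one a b)).1
  · exact
      { forall_aemeasurable := fun M => (EnergyWalk.measurable_lifetime_div _ _).aemeasurable
        aemeasurable_limit := by fun_prop
        tendsto := EnergyWalk.tendsto_lifetimeLaw hρ hν hN hNρ }
  · refine (EnergyWalk.tendsto_mean_lifetimeLaw hρ hν hN hNρ).congr' ?_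
    filter_upwards [hN.eventually_ge_atTop 2, EnergyWalk.eventually_surv_pos hρ hN hNρ,
      eventually_gt_atTop 0] with M a b c
    exact (EnergyWalk.lintegral_lifetime_div a c b).symm
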